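/- Let $N\ge 3$, $M\ge 1$, $K\ge 0$ be integers with $N=K+2M$, let $\Omega\subseteq\mathbb R^N$ be open (for instance $\Omega=\mathbb R^N$), and let $J=(J_{ij})$ be a smooth skew-symmetric matrix field on $\Omega$ such that $\{A,B\}=J_{ij}\,\partial_iA\,\partial_jB$ satisfies the Jacobi identity for all smooth $A,B,C$ on $\Omega$ (a Poisson bracket; repeated indices are summed from $1$ to $N$). Assume that $J(z)$ has constant rank $2M=N-K$ for $z\in\Omega$, so that $K$ is its corank (the number of local independent Casimir invariants). A *tri-linear Nambu bracket* on an open set $V$ is a bracket $\{A,B,C\}=\lambda_{ijk}\,\partial_iA\,\partial_jB\,\partial_kC$ with a smooth totally antisymmetric tensor field $\lambda$ on $V$ (so it is skew-symmetric and satisfies the Leibniz rule) which satisfies the fundamental identity $$\{\{A,B,C\},D,E\}=\{\{A,D,E\},B,C\}+\{A,\{B,D,E\},C\}+\{A,B,\{C,D,E\}\}$$ for all smooth $A,B,C,D,E$ on $V$. It *generates* $J$ on $V$ through a smooth function $C$ on $V$ if $\{A,B\}=\{A,B,C\}$ on $V$ for all smooth $A,B$ on $V$. Then: 1. For every $z\in\Omega$: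 there are an open neighbourhood $V\subseteq\Omega$ of $z$, a tri-linear Nambu bracket on $V$ and a smooth function $C$ on $V$ through which it generates $J$ on $V$, if and only if $M=1$, i.e. $N=K+2$. 2. (Necessity.) If $J$ is generated by a tri-linear Nambu bracket on an open set $V\subseteq\Omega$, then at every point of $V$ $$J_{ij}J_{mk}+J_{jk}J_{mi}+J_{ki}J_{mj}=0\qquad\text{for all } i,j,k,m;$$ and if these relations hold at some point of $\Omega$, then $N=K+2$. 3. (Sufficiency.) If $N=K+2$, then every point of $\Omega$ has an open neighbourhood in $\Omega$ with smooth coordinates $x=h(z)$ (Darboux coordinates) in which $J$ becomes the constant matrix $\widetilde J$ with $\widetilde J_{12}=-\widetilde J_{21}=1$ and all other entries $0$. Moreover, for any Darboux coordinates $h$ on an open set $V\subseteq\Omega$, the tensor which in the coordinates $x$ is the constant tensor given by the Levi-Civita symbol on the indices $(1,2,N)$, and $0$ if another index occurs, defines a tri-linear Nambu bracket on $V$ that generates $J$ on $V$ through $C=x_N=h_N$. -/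

import Mathlib

open scoped ContDiff

namespace Nambu

/-- The phase space `ℝ^N` with coordinates `z 0, …, z (N - 1)`
(the indices `1, …, N` of the mathematical text are shifted by one). -/
abbrev Phase (N : ℕ) : Type := Fin N → ℝ

/-- The partial derivative `∂A/∂z_i` of `A` at the point `z`. -/
noncomputable def pderiv {N : ℕ} (i : Fin N) (A : Phase N → ℝ) (z : Phase N) : ℝ :=
  fderiv ℝ A z (Pi.single i 1)

/-- An observable on the (open) set `V`: a real function that is smooth on `V`. -/
def IsObservable {N : ℕ} (V : Set (Phase N)) (A : Phase N → ℝ) : Prop :=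
  ContDiffOn ℝ ∞ A V

/-- The bracket `{A, B} = J_{ij} ∂A/∂z_i ∂B/∂z_j` of a matrix field `J`. -/
noncomputable def poissonBracket {N : ℕ} (J : Phase N → Matrix (Fin N) (Fin N) ℝ)
    (A B : Phase N → ℝ) : Phase N → ℝ :=
  fun z => ∑ i, ∑ j, J z i j * pderiv i A z * pderiv j B z

/-- The bracket `{A, B, C} = L_{ijk} ∂A/∂z_i ∂B/∂z_j ∂C/∂z_k` of a tensor field `L`. -/
noncomputable def nambuBracket {N : ℕ} (L : Phase N → Fin N → Fin N → Fin N → ℝ)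
    (A B C : Phase N → ℝ) : Phase N → ℝ :=
  fun z => ∑ i, ∑ j, ∑ k, L z i j k * pderiv i A z * pderiv j B z * pderiv k C z

/-- The bracket of any tensor field satisfies the Leibniz rule
`{AB, C, D} = A {B, C, D} + {A, C, D} B`. -/
theorem nambuBracket_leibniz {N : ℕ} (L : Phase N → Fin N → Fin N → Fin N → ℝ)
    (A B C D : Phase N → ℝ) (z : Phase N)
    (hA : DifferentiableAt ℝ A z) (hB : DifferentiableAt ℝ B z) :
    nambuBracket L (fun y => A y * B y) C D z
      = A z * nambuBracket L B C D z + nambuBracket L A C D z * B z := by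
  have h : ∀ i, pderiv i (fun y => A y * B y) z
      = A z * pderiv i B z + pderiv i A z * B z := by
    intro i
    simp only [pderiv]
    rw [fderiv_fun_mul hA hB]
    simp
    ring
  simp only [nambuBracket, h, Finset.mul_sum, Finset.sum_mul, ← Finset.sum_add_distrib]
  refine Finset.sum_congr rfl fun i _ => Finset.sum_congr rfl fun j _ =>
    Finset.sum_congr rfl fun k _ => ?_
  ring

/-- `J` is a (smooth) Poisson matrix on the open set `V`: its bracket is skew-symmetric and
satisfies the Jacobi identity for all observables on `V`. -/
structure IsPoissonOn {N : ℕ} (V : Set (Phase N))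
    (J : Phase N → Matrix (Fin N) (Fin N) ℝ) : Prop where
  smooth : ∀ i j, ContDiffOn ℝ ∞ (fun z => J z i j) V
  skew : ∀ z ∈ V, ∀ i j, J z i j = -J z j i
  jacobi : ∀ A B C : Phase N → ℝ,
    IsObservable V A → IsObservable V B → IsObservable V C → ∀ z ∈ V,
      poissonBracket J (poissonBracket J A B) C z
        + poissonBracket J (poissonBracket J B C) A z
        + poissonBracket J (poissonBracket J C A) B z = 0

/-- `L` is a (smooth) Nambu tensor on the open set `V`: it is totally antisymmetric and its
bracket satisfies the fundamental identity for all observables on `V`. (The Leibniz rule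
holds by `nambuBracket_leibniz`.) -/
structure IsNambuOn {N : ℕ} (V : Set (Phase N))
    (L : Phase N → Fin N → Fin N → Fin N → ℝ) : Prop where
  smooth : ∀ i j k, ContDiffOn ℝ ∞ (fun z => L z i j k) V
  skew_left : ∀ z ∈ V, ∀ i j k, L z i j k = -L z j i k
  skew_right : ∀ z ∈ V, ∀ i j k, L z i j k = -L z i k j
  fundamental : ∀ A B C D E : Phase N → ℝ,
    IsObservable V A → IsObservable V B → IsObservable V C → IsObservable V D →
    IsObservable V E → ∀ z ∈ V,
      nambuBracket L (nambuBracket L A B C) D E z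
        = nambuBracket L (nambuBracket L A D E) B C z
          + nambuBracket L A (nambuBracket L B D E) C z
          + nambuBracket L A B (nambuBracket L C D E) z

/-- On `V`, the bracket of `J` is generated by the tri-linear bracket of `L` and the
observable `C`: `{A, B} = {A, B, C}` for all observables `A`, `B` on `V`. -/
def Generates {N : ℕ} (V : Set (Phase N)) (L : Phase N → Fin N → Fin N → Fin N → ℝ)
    (C : Phase N → ℝ) (J : Phase N → Matrix (Fin N) (Fin N) ℝ) : Prop :=
  IsObservable V C ∧ ∀ A B : Phase N → ℝ, IsObservable V A → IsObservable V B →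
    ∀ z ∈ V, poissonBracket J A B z = nambuBracket L A B C z

/-- On `V`, the bracket of `J` is derived from some tri-linear Nambu bracket on `V`. -/
def HasNambuBracketOn {N : ℕ} (V : Set (Phase N))
    (J : Phase N → Matrix (Fin N) (Fin N) ℝ) : Prop :=
  ∃ (L : Phase N → Fin N → Fin N → Fin N → ℝ) (C : Phase N → ℝ),
    IsNambuOn V L ∧ Generates V L C J

/-- The matrix field `J`, expressed in the new variables `x = h z` with inverse `z = g x`. -/
noncomputable def changeMatrix {N : ℕ} (h g : Phase N → Phase N)
    (J : Phase N → Matrix (Fin N) (Fin N) ℝ) : Phase N → Matrix (Fin N) (Fin N) ℝ :=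
  fun x i j => ∑ m, ∑ n,
    J (g x) m n * pderiv m (fun z => h z i) (g x) * pderiv n (fun z => h z j) (g x)

/-- The tensor field `L`, expressed in the new variables `x = h z` with inverse `z = g x`. -/
noncomputable def changeTensor {N : ℕ} (h g : Phase N → Phase N)
    (L : Phase N → Fin N → Fin N → Fin N → ℝ) : Phase N → Fin N → Fin N → Fin N → ℝ :=
  fun x i j k => ∑ m, ∑ n, ∑ p,
    L (g x) m n p * pderiv m (fun z => h z i) (g x) * pderiv n (fun z => h z j) (g x)
      * pderiv p (fun z => h z k) (g x)

/-- The Darboux normal form of rank `2 M`: the block matrix with rows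
`(0, I, 0)`, `(-I, 0, 0)`, `(0, 0, 0)` and blocks of sizes `M`, `M`, `N - 2 M`. -/
def darbouxMatrix (N M : ℕ) : Matrix (Fin N) (Fin N) ℝ :=
  fun i j =>
    if (i : ℕ) < M ∧ (j : ℕ) = i + M then 1
    else if (j : ℕ) < M ∧ (i : ℕ) = j + M then -1
    else 0

/-- The constant tensor equal to the three-dimensional Levi-Civita symbol on the first, second
and last index, and zero if another index occurs. -/
noncomputable def leviCivitaTensor (N : ℕ) : Fin N → Fin N → Fin N → ℝ :=
  fun i j k => Matrix.det (Matrix.of fun r s : Fin 3 =>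
    if ((![i, j, k] r : Fin N) : ℕ) = ![0, 1, N - 1] s then (1 : ℝ) else 0)

/-- `h` is a smooth local change of variables (with smooth inverse, between the open sets
`h.source` and `h.target`) in which `J` takes the Darboux normal form of rank `2 M`. -/
structure IsDarbouxChart {N : ℕ} (M : ℕ) (h : OpenPartialHomeomorph (Phase N) (Phase N))
    (J : Phase N → Matrix (Fin N) (Fin N) ℝ) : Prop where
  smooth : ContDiffOn ℝ ∞ h h.source
  smooth_symm : ContDiffOn ℝ ∞ h.symm h.target
  normal_form : ∀ x ∈ h.target, changeMatrix h h.symm J x = darbouxMatrix N M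

/-- The quadratic relations
`J_{ij} J_{mk} + J_{jk} J_{mi} + J_{ki} J_{mj} = 0` for all `i, j, k, m`. -/
def QuadraticRelations {N : ℕ} (P : Matrix (Fin N) (Fin N) ℝ) : Prop :=
  ∀ i j k m, P i j * P m k + P j k * P m i + P k i * P m j = 0

end Nambu

/-! Necessity is pointwise algebra. For fixed observables `G`, `C` on `V`, the fundamental identity
makes D = {·, G, C} a derivation of the tri-linear bracket. Replacing `G` by `G * C` replaces D by
C·D, which must again be a derivation. Expanding the difference by the Leibniz rule leaves only the
terms in which C itself is bracketed, a quadratic relation among the brackets with `C`. On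
coordinate functions these are entries of `J`, which gives the quadratic relations. If some entry `P
p q` is nonzero, they express every column of `P` through columns `p` and `q`, so the rank is at
most 2 and M = 1.

Sufficiency rests on Darboux's theorem in rank two. Choose a coordinate Q whose Hamiltonian field X
does not vanish, and straighten X to find P with {Q, P} = 1. By the Jacobi identity, the Hamiltonian
field Y of P is invariant along X in the straightened picture, so it descends to a transversal
hyperplane, where it can be straightened as well. This yields K further functions that commute with
Q and P; they commute with each other because the rank is only 2. In such coordinates the
Levi-Civita bracket is a Jacobian determinant in three variables. It satisfies the fundamental
identity by symmetry of second derivatives, and filling its last slot with x_N leaves the canonical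
bracket.

Straightening needs flows that depend smoothly on time and initial point. They come from the inverse
function theorem, applied to the rescaled integral equation on the Banach space of curves over the
unit interval. -/

open Topology Set Filter

namespace Nambu

/-! ### Smoothness of composition operators on spaces of continuous curves -/

section Superposition

variable {X : Type*} [TopologicalSpace X] [CompactSpace X]
variable {E : Type*} [NormedAddCommGroup E] [NormedSpace ℝ E]

/-- Pointwise application of a continuous family of operators to a continuous family of vectors,
as a continuous bilinear map. -/
noncomputable def pointwiseApply (X : Type*) [TopologicalSpace X] [CompactSpace X]
    (E F : Type*) [NormedAddCommGroup E] [NormedSpace ℝ E]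
    [NormedAddCommGroup F] [NormedSpace ℝ F] :
    C(X, E →L[ℝ] F) →L[ℝ] C(X, E) →L[ℝ] C(X, F) :=
  LinearMap.mkContinuous₂
    (LinearMap.mk₂ ℝ (fun (T : C(X, E →L[ℝ] F)) (h : C(X, E)) =>
        (⟨fun s => T s (h s), by fun_prop⟩ : C(X, F)))
      (fun _ _ _ => by ext; simp) (fun _ _ _ => by ext; simp)
      (fun _ _ _ => by ext; simp) (fun _ _ _ => by ext; simp)) 1
    (fun T h => by
      rw [ContinuousMap.norm_le _ (by positivity)]
      intro s
      rw [one_mul]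
      exact (T s).le_of_opNorm_le_of_le (T.norm_coe_le_norm s) (h.norm_coe_le_norm s))

@[simp]
theorem pointwiseApply_apply {F : Type*} [NormedAddCommGroup F] [NormedSpace ℝ F]
    (T : C(X, E →L[ℝ] F)) (h : C(X, E)) (s : X) :
    pointwiseApply X E F T h s = T s (h s) := rfl

/-- The remainder at `s` is bounded by the mean value inequality on the segment from `u s` to `u s +
h s`. The bound is uniform in `s` because `v ↦ f' ∘ v` is continuous for the sup norm, `X` being
compact. -/
theorem hasFDerivAt_superposition {F : Type*} [NormedAddCommGroup F] [NormedSpace ℝ F]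
    {f : E → F} (hf : Continuous f) {f' : E → E →L[ℝ] F} (hf' : Continuous f')
    (hd : ∀ x, HasFDerivAt f (f' x) x) (u : C(X, E)) :
    HasFDerivAt (fun u : C(X, E) => (⟨f, hf⟩ : C(E, F)).comp u)
      (pointwiseApply X E F ((⟨f', hf'⟩ : C(E, E →L[ℝ] F)).comp u)) u := by
  rw [hasFDerivAt_iff_isLittleO_nhds_zero, Asymptotics.isLittleO_iff]
  intro ε hε
  have hc : Continuous fun v : C(X, E) => (⟨f', hf'⟩ : C(E, E →L[ℝ] F)).comp v :=
    ContinuousMap.continuous_postcomp _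
  obtain ⟨δ, hδ, H⟩ := Metric.continuousAt_iff
    (f := fun v : C(X, E) => (⟨f', hf'⟩ : C(E, E →L[ℝ] F)).comp v) |>.1 hc.continuousAt ε hε
  filter_upwards [Metric.ball_mem_nhds (0 : C(X, E)) hδ] with h hh
  rw [mem_ball_zero_iff] at hh
  rw [ContinuousMap.norm_le _ (by positivity)]
  intro s
  have hb : ∀ y ∈ segment ℝ (u s) (u s + h s), ‖f' y - f' (u s)‖ ≤ ε := by
    intro y hy
    rw [segment_eq_image'] at hy
    obtain ⟨t, ht, rfl⟩ := hy
    have h1 : dist (u + t • h) u < δ := by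
      rw [dist_eq_norm, add_sub_cancel_left, norm_smul, Real.norm_of_nonneg ht.1]
      exact (mul_le_of_le_one_left (norm_nonneg _) ht.2).trans_lt hh
    have h2 := (ContinuousMap.dist_apply_le_dist s).trans (H h1).le
    simpa [dist_eq_norm] using h2
  have := (convex_segment (u s) (u s + h s)).norm_image_sub_le_of_norm_hasFDerivWithin_le'
    (fun y _ => (hd y).hasFDerivWithinAt) hb (left_mem_segment ℝ _ _) (right_mem_segment ℝ _ _)
  simp only [add_sub_cancel_left] at this
  refine le_trans (by simpa using this) ?_
  gcongr
  exact h.norm_coe_le_norm s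

-- Induction on the order: the derivative is the superposition operator of `fderiv ℝ f` followed by
-- a continuous linear map. The two spaces share a universe because the induction replaces `F` by `E
-- →L[ℝ] F`.
universe u in
theorem contDiff_superposition_nat (n : ℕ) {E : Type u} [NormedAddCommGroup E] [NormedSpace ℝ E]
    {F : Type u} [NormedAddCommGroup F] [NormedSpace ℝ F] (f : C(E, F)) (hf : ContDiff ℝ n f) :
    ContDiff ℝ n (fun u : C(X, E) => f.comp u) := by
  induction n generalizing F with
  | zero =>
    exact contDiff_zero.2 (ContinuousMap.continuous_postcomp f)
  | succ n ih =>
    have hf1 : ContDiff ℝ ((n : WithTop ℕ∞) + 1) f := by exact_mod_cast hf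
    have hn : ContDiff ℝ n (fderiv ℝ f) := (contDiff_succ_iff_fderiv.1 hf1).2.2
    have hd : ∀ x, HasFDerivAt f (fderiv ℝ f x) x := fun x =>
      (contDiff_succ_iff_fderiv.1 hf1).1.differentiableAt.hasFDerivAt
    push_cast
    rw [contDiff_succ_iff_hasFDerivAt]
    refine ⟨_, ?_, fun u => hasFDerivAt_superposition f.continuous hn.continuous hd u⟩
    exact (pointwiseApply X E F).contDiff.comp (ih ⟨fderiv ℝ f, hn.continuous⟩ hn)

universe u in
theorem contDiff_superposition {E F : Type u} [NormedAddCommGroup E] [NormedSpace ℝ E]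
    [NormedAddCommGroup F] [NormedSpace ℝ F] (f : C(E, F)) (hf : ContDiff ℝ ∞ f) :
    ContDiff ℝ ∞ (fun u : C(X, E) => f.comp u) :=
  contDiff_infty.2 fun n => contDiff_superposition_nat n f (contDiff_infty.1 hf n)

end Superposition

/-! ### Smooth local inverses and smooth extension of germs -/

/-- The inverse function theorem in the smooth category. -/
theorem exists_smooth_local_inverse {E F : Type*} [NormedAddCommGroup E] [NormedSpace ℝ E]
    [CompleteSpace E] [NormedAddCommGroup F] [NormedSpace ℝ F] [CompleteSpace F] {f : E → F}
    {U : Set E} (hU : IsOpen U) (hf : ContDiffOn ℝ ∞ f U) {a : E} (ha : a ∈ U) {f' : E ≃L[ℝ] F}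
    (hf' : HasFDerivAt f (f' : E →L[ℝ] F) a) :
    ∃ e : OpenPartialHomeomorph E F, (e : E → F) = f ∧ a ∈ e.source ∧ e.source ⊆ U ∧
      ContDiffOn ℝ ∞ e.symm e.target := by
  have hfa : ∀ x ∈ U, ContDiffAt ℝ ∞ f x := fun x hx => hf.contDiffAt (hU.mem_nhds hx)
  let e := (hfa a ha).toOpenPartialHomeomorph f hf' (by simp)
  have hea : a ∈ e.source := (hfa a ha).mem_toOpenPartialHomeomorph_source hf' (by simp)
  -- Restricting to the open set where the differential is invertible makes the inverse smooth on
  -- the whole target, not only at the image of `a`.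
  let W : Set E := U ∩ fderiv ℝ f ⁻¹' (range ((↑) : (E ≃L[ℝ] F) → E →L[ℝ] F))
  have hW : IsOpen W := (hf.continuousOn_fderiv_of_isOpen hU (by simp)).isOpen_inter_preimage hU
    ContinuousLinearEquiv.isOpen
  have haW : a ∈ W := ⟨ha, f', hf'.fderiv.symm⟩
  refine ⟨e.restrOpen W hW, rfl, ⟨hea, haW⟩, fun x hx => hx.2.1, ?_⟩
  intro y hy
  obtain ⟨hyU, g, hg⟩ := ((e.restrOpen W hW).map_target hy).2
  refine ((e.restrOpen W hW).contDiffAt_symm (f₀' := g) hy ?_ (hfa _ hyU)).contDiffWithinAt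
  rw [hg]
  exact ((hfa _ hyU).differentiableAt (by simp)).hasFDerivAt

/-- A function that is smooth near a point has a globally smooth representative of its germ. -/
theorem exists_contDiff_eventuallyEq {E F : Type*} [NormedAddCommGroup E] [NormedSpace ℝ E]
    [FiniteDimensional ℝ E] [NormedAddCommGroup F] [NormedSpace ℝ F] {f : E → F}
    {U : Set E} (hU : IsOpen U) (hf : ContDiffOn ℝ ∞ f U) {a : E} (ha : a ∈ U) :
    ∃ g : E → F, ContDiff ℝ ∞ g ∧ g =ᶠ[𝓝 a] f := by
  obtain ⟨ε, hε, hεU⟩ := Metric.isOpen_iff.1 hU a ha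
  let χ : ContDiffBump a := ⟨ε / 4, ε / 2, by positivity, by linarith⟩
  refine ⟨fun x => χ x • f x, contDiff_iff_contDiffAt.2 fun x => ?_, ?_⟩
  · by_cases hx : x ∈ U
    · exact χ.contDiff.contDiffAt.smul (hf.contDiffAt (hU.mem_nhds hx))
    · have hx' : x ∉ tsupport χ := by
        rw [χ.tsupport_eq]
        exact fun h => hx (hεU (Metric.closedBall_subset_ball (half_lt_self hε) h))
      refine (contDiffAt_const (c := (0 : F))).congr_of_eventuallyEq ?_
      filter_upwards [notMem_tsupport_iff_eventuallyEq.1 hx'] with y hy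
      simp [hy]
  · filter_upwards [χ.eventuallyEq_one] with y hy
    simp [hy]

/-! ### Smooth local flows from the integral equation -/

section Flow

variable {E : Type*} [NormedAddCommGroup E] [NormedSpace ℝ E]

theorem continuous_comp_projIcc {E : Type*} [TopologicalSpace E] (u : C(unitInterval, E)) :
    Continuous fun r : ℝ => u (projIcc 0 1 zero_le_one r) :=
  u.continuous.comp continuous_projIcc

/-- The primitive vanishing at `0`, as an operator on curves over the unit interval. -/
noncomputable def primitive (E : Type*) [NormedAddCommGroup E] [NormedSpace ℝ E] :
    C(unitInterval, E) →L[ℝ] C(unitInterval, E) :=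
  LinearMap.mkContinuous
    { toFun := fun u => ⟨fun s => ∫ r in (0 : ℝ)..s, u (projIcc 0 1 zero_le_one r),
        (intervalIntegral.continuous_primitive
          (fun _ _ => (continuous_comp_projIcc u).intervalIntegrable _ _) 0).comp
            continuous_subtype_val⟩
      map_add' := fun u v => by
        ext s
        exact intervalIntegral.integral_add ((continuous_comp_projIcc u).intervalIntegrable _ _)
          ((continuous_comp_projIcc v).intervalIntegrable _ _)
      map_smul' := fun c u => by
        ext s
        exact intervalIntegral.integral_smul c _ } 1
    (fun u => by
      rw [ContinuousMap.norm_le _ (by positivity), one_mul]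
      intro s
      have := intervalIntegral.norm_integral_le_of_norm_le_const (a := 0) (b := (s : ℝ))
        (f := fun r : ℝ => u (projIcc 0 1 zero_le_one r)) (C := ‖u‖)
        (fun r _ => u.norm_coe_le_norm _)
      refine this.trans (mul_le_of_le_one_right (norm_nonneg _) ?_)
      rw [sub_zero, abs_of_nonneg s.2.1]
      exact s.2.2)

theorem primitive_apply (u : C(unitInterval, E)) (s : unitInterval) :
    primitive E u s = ∫ r in (0 : ℝ)..s, u (projIcc 0 1 zero_le_one r) := rfl

/-- Substitution in the integral. It turns a solution of the integral equation for time `t` into one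
for time `s * t`, by running through the curve more slowly. -/
theorem primitive_comp_mul (u : C(unitInterval, E)) (s t : unitInterval) :
    (s : ℝ) • primitive E (u.comp ⟨fun r => s * r, by fun_prop⟩) t = primitive E u (s * t) := by
  rw [primitive_apply, primitive_apply]
  have := intervalIntegral.smul_integral_comp_mul_left
    (f := fun r : ℝ => u (projIcc 0 1 zero_le_one r)) (a := 0) (b := (t : ℝ)) (s : ℝ)
  rw [mul_zero] at this
  rw [Set.Icc.coe_mul, ← this]
  congr 1
  refine intervalIntegral.integral_congr fun r hr => ?_
  rw [uIcc_of_le t.2.1] at hr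
  have hr1 : r ∈ Icc (0 : ℝ) 1 := ⟨hr.1, hr.2.trans t.2.2⟩
  have hr2 : (s : ℝ) * r ∈ Icc (0 : ℝ) 1 :=
    ⟨mul_nonneg s.2.1 hr1.1, mul_le_one₀ s.2.2 hr1.1 hr1.2⟩
  simp only [ContinuousMap.comp_apply, ContinuousMap.coe_mk]
  rw [projIcc_of_mem _ hr1, projIcc_of_mem _ hr2]
  rfl

/-- Constant curves, as a continuous linear map. -/
noncomputable def constCurve (E : Type*) [NormedAddCommGroup E] [NormedSpace ℝ E] :
    E →L[ℝ] C(unitInterval, E) :=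
  LinearMap.mkContinuous
    { toFun := fun x => ContinuousMap.const _ x
      map_add' := fun _ _ => rfl
      map_smul' := fun _ _ => rfl } 1
    (fun x => by
      rw [ContinuousMap.norm_le _ (by positivity), one_mul]
      exact fun _ => le_rfl)

@[simp]
theorem constCurve_apply (x : E) (s : unitInterval) : constCurve E x s = x := rfl

/-- The rescaled integral equation `u = x + t ∫ f(u)` has a solution near `t = 0` which is smooth
in `(t, x)`, and unique in a neighbourhood. -/
theorem exists_smooth_solution [CompleteSpace E] (f : C(E, E)) (hf : ContDiff ℝ ∞ f) (x₀ : E) :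
    ∃ (S : ℝ × E → C(unitInterval, E)) (U : Set (ℝ × E)), IsOpen U ∧ (0, x₀) ∈ U ∧
      ContDiffOn ℝ ∞ S U ∧
      (∀ p ∈ U, S p = constCurve E p.2 + p.1 • primitive E (f.comp (S p))) ∧
      (∀ p ∈ U, ∀ s t : unitInterval, S (s * p.1, p.2) t = S p (s * t)) := by
  -- Solutions are the preimages of `(p, 0)`. At time 0 the factor `t` kills the derivative of the
  -- integral term in `u`, so the differential of `Θ` at `a` is unipotent block triangular, with
  -- off-diagonal block `L`.
  let Θ : (ℝ × E) × C(unitInterval, E) → (ℝ × E) × C(unitInterval, E) := fun q =>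
    (q.1, q.2 - (constCurve E q.1.2 + q.1.1 • primitive E (f.comp q.2)))
  have hP : ContDiff ℝ ∞ fun u : C(unitInterval, E) => primitive E (f.comp u) :=
    (primitive E).contDiff.comp (contDiff_superposition f hf)
  have hΘ : ContDiff ℝ ∞ Θ := by
    refine contDiff_fst.prodMk (contDiff_snd.sub (ContDiff.add ?_ ?_))
    · exact (constCurve E).contDiff.comp (contDiff_snd.comp contDiff_fst)
    · exact (contDiff_fst.comp contDiff_fst).smul (hP.comp contDiff_snd)
  let a : (ℝ × E) × C(unitInterval, E) := ((0, x₀), constCurve E x₀)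
  let L : (ℝ × E) →L[ℝ] C(unitInterval, E) :=
    -((constCurve E).comp (ContinuousLinearMap.snd ℝ ℝ E) +
      (ContinuousLinearMap.fst ℝ ℝ E).smulRight (primitive E (f.comp (constCurve E x₀))))
  let Θ' : ((ℝ × E) × C(unitInterval, E)) ≃L[ℝ] ((ℝ × E) × C(unitInterval, E)) :=
    (ContinuousLinearEquiv.refl ℝ (ℝ × E)).skewProd (ContinuousLinearEquiv.refl ℝ _) L
  have hΘ' : HasFDerivAt Θ
      (Θ' : ((ℝ × E) × C(unitInterval, E)) →L[ℝ] ((ℝ × E) × C(unitInterval, E))) a := by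
    have h1 : HasFDerivAt (fun q : (ℝ × E) × C(unitInterval, E) => constCurve E q.1.2) _ a :=
      ((constCurve E).comp ((ContinuousLinearMap.snd ℝ ℝ E).comp
        (ContinuousLinearMap.fst ℝ (ℝ × E) C(unitInterval, E)))).hasFDerivAt
    have h2 : HasFDerivAt (fun q : (ℝ × E) × C(unitInterval, E) => q.1.1) _ a :=
      ((ContinuousLinearMap.fst ℝ ℝ E).comp
        (ContinuousLinearMap.fst ℝ (ℝ × E) C(unitInterval, E))).hasFDerivAt
    have h3 : HasFDerivAt (fun q : (ℝ × E) × C(unitInterval, E) => primitive E (f.comp q.2)) _ a :=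
      ((hP.comp contDiff_snd).differentiable (by simp)).differentiableAt.hasFDerivAt
    refine (hasFDerivAt_fst.prodMk (hasFDerivAt_snd.sub (h1.add (h2.smul h3)))).congr_fderiv ?_
    ext q <;> simp [Θ', L, a, sub_eq_add_neg]
  obtain ⟨e, he, hae, -, hes⟩ := exists_smooth_local_inverse isOpen_univ hΘ.contDiffOn
    (mem_univ a) hΘ'
  obtain ⟨r, hr, hrs⟩ := Metric.isOpen_iff.1 e.open_source a hae
  have hΘa : Θ a = ((0, x₀), 0) := by simp [Θ, a]
  have hTa : ((0, x₀), 0) ∈ e.target := by rw [← hΘa, ← he]; exact e.map_source hae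
  let ι : ℝ × E → (ℝ × E) × C(unitInterval, E) := fun p => (p, 0)
  have hι : ContDiff ℝ ∞ ι := contDiff_id.prodMk contDiff_const
  let T := e.target ∩ e.symm ⁻¹' Metric.ball a r
  have hT : IsOpen T := e.symm.isOpen_inter_preimage Metric.isOpen_ball
  -- Uniqueness of the solution inside the ball, from injectivity of `e` there.
  have key : ∀ (p : ℝ × E) (u : C(unitInterval, E)), (p, u) ∈ Metric.ball a r →
      u = constCurve E p.2 + p.1 • primitive E (f.comp u) → e.symm (ι p) = (p, u) := by
    intro p u hpu hu
    have h1 : e (p, u) = ι p := by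
      rw [he]
      simp only [Θ, ι, Prod.mk.injEq, true_and]
      exact sub_eq_zero.2 hu
    rw [← h1]
    exact e.left_inv (hrs hpu)
  have hsol : ∀ p, ι p ∈ T → e.symm (ι p) = (p, (e.symm (ι p)).2) ∧
      (e.symm (ι p)).2 = constCurve E p.2 + p.1 • primitive E (f.comp (e.symm (ι p)).2) := by
    intro p hp
    have h1 : Θ (e.symm (ι p)) = ι p := by rw [← he]; exact e.right_inv hp.1
    have h2 : (e.symm (ι p)).1 = p := congrArg Prod.fst h1
    have h3 := congrArg Prod.snd h1
    simp only [Θ, h2, ι] at h3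
    exact ⟨Prod.ext h2 rfl, sub_eq_zero.1 h3⟩
  refine ⟨fun p => (e.symm (ι p)).2, ι ⁻¹' T, hT.preimage hι.continuous, ⟨hTa, ?_⟩, ?_, ?_, ?_⟩
  · have : e.symm (ι (0, x₀)) = a := by
      change e.symm ((0, x₀), 0) = a
      rw [← hΘa, ← he]
      exact e.left_inv hae
    rw [mem_preimage, this]
    exact Metric.mem_ball_self hr
  · exact contDiff_snd.comp_contDiffOn (hes.comp hι.contDiffOn fun p hp => hp.1)
  · exact fun p hp => (hsol p hp).2
  · intro p hp s t
    obtain ⟨h1, h2⟩ := hsol p hp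
    set u := (e.symm (ι p)).2 with hu
    -- The slowed curve solves the equation for time `s * p.1`. It stays in the ball because the
    -- centre `a` has time 0 and a constant curve, so uniqueness identifies it.
    let v : C(unitInterval, E) := u.comp ⟨fun r => s * r, by fun_prop⟩
    have hball : (p, u) ∈ Metric.ball a r := h1 ▸ hp.2
    have hv : (((s : ℝ) * p.1, p.2), v) ∈ Metric.ball a r := by
      simp only [a, Metric.mem_ball, Prod.dist_eq, max_lt_iff, dist_zero_right] at hball ⊢
      refine ⟨⟨?_, hball.1.2⟩, ?_⟩
      · rw [norm_mul, Real.norm_of_nonneg s.2.1]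
        exact (mul_le_of_le_one_left (norm_nonneg _) s.2.2).trans_lt hball.1.1
      · refine lt_of_le_of_lt ?_ hball.2
        rw [ContinuousMap.dist_le dist_nonneg]
        exact fun x => ContinuousMap.dist_apply_le_dist (f := u) (g := constCurve E x₀) (s * x)
    have heq : v = constCurve E p.2 + ((s : ℝ) * p.1) • primitive E (f.comp v) := by
      ext x
      have h3 := congrArg (fun w : C(unitInterval, E) => w (s * x)) h2
      simp only [ContinuousMap.add_apply, ContinuousMap.smul_apply, constCurve_apply] at h3 ⊢
      rw [← primitive_comp_mul, smul_smul, mul_comm p.1] at h3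
      exact h3
    have := key ((s : ℝ) * p.1, p.2) v hv heq
    simp only [this]
    rfl

/-- Smooth vector fields have smooth local flows. -/
theorem exists_smooth_flow [CompleteSpace E] {f : E → E} (hf : ContDiff ℝ ∞ f) (x₀ : E) :
    ∃ (φ : ℝ × E → E) (U : Set (ℝ × E)), IsOpen U ∧ (0, x₀) ∈ U ∧ ContDiffOn ℝ ∞ φ U ∧
      (∀ x, (0, x) ∈ U → φ (0, x) = x) ∧
      ∀ p ∈ U, HasDerivAt (fun t => φ (t, p.2)) (f (φ p)) p.1 := by
  obtain ⟨S, U, hU, hxU, hS, hsol, hscale⟩ :=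
    exists_smooth_solution ⟨f, hf.continuous⟩ hf x₀
  have hS0 : ∀ x, (0, x) ∈ U → S (0, x) = constCurve E x := fun x hx => by
    simpa using hsol _ hx
  let ev : C(unitInterval, E) →L[ℝ] E := ContinuousMap.evalCLM ℝ 1
  let φ : ℝ × E → E := fun p => ev (S p)
  -- Time is doubled so that, for `t ≠ 0`, the time `t` sits at the interior parameter 1/2 of the
  -- single curve `S (2 * t, x)`. The scaling property then puts `φ (σ, x)` on that curve for `σ`
  -- near `t`, and the fundamental theorem of calculus applies.
  let d : ℝ × E → ℝ × E := fun p => (2 * p.1, p.2)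
  have hd : Continuous d := by fun_prop
  refine ⟨φ, U ∩ d ⁻¹' U, hU.inter (hU.preimage hd), ⟨hxU, by simpa [d] using hxU⟩,
    ev.contDiff.comp_contDiffOn (hS.mono inter_subset_left), ?_, ?_⟩
  · intro x hx
    simp [φ, hS0 x hx.1, ev]
  · rintro ⟨t, x⟩ ⟨hp, hp2⟩
    by_cases ht : t = 0
    · subst ht
      -- At time 0 the flow is `x + t • g t` with `g` differentiable, so its derivative is `g 0 = f
      -- x`.
      let g : ℝ → E := fun t => ev (primitive E (ContinuousMap.comp ⟨f, hf.continuous⟩ (S (t, x))))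
      have hg : DifferentiableAt ℝ g 0 := by
        have h1 : DifferentiableAt ℝ S (0, x) :=
          (hS.contDiffAt (hU.mem_nhds hp)).differentiableAt (by simp)
        have h2 : DifferentiableAt ℝ (fun t : ℝ => S (t, x)) 0 :=
          h1.comp (0 : ℝ) (differentiableAt_id.prodMk (differentiableAt_const x))
        have h3 := ((contDiff_superposition (X := unitInterval) ⟨f, hf.continuous⟩ hf).differentiable
          (by simp)).differentiableAt (x := S (0, x))
        exact (ev.comp (primitive E)).differentiableAt.comp (0 : ℝ) (DifferentiableAt.fun_comp'
          (g := fun u : C(unitInterval, E) => ContinuousMap.comp ⟨f, hf.continuous⟩ u)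
          (0 : ℝ) h3 h2)
      have h4 := ((hasDerivAt_id (0 : ℝ)).smul hg.hasDerivAt).const_add x
      have h5 : ev (primitive E (ContinuousMap.comp ⟨f, hf.continuous⟩ (constCurve E x))) = f x := by
        simp [ev, primitive_apply]
      have h6 : (0 : ℝ) • deriv g 0 + (1 : ℝ) • g 0 = f (φ (0, x)) := by
        simp only [g, φ, hS0 x hp, h5]
        simp [ev]
      refine (h6 ▸ h4).congr_of_eventuallyEq ?_
      have hnear : ∀ᶠ t : ℝ in 𝓝 0, (t, x) ∈ U :=
        (Continuous.prodMk_left x).continuousAt.eventually (hU.mem_nhds hp)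
      filter_upwards [hnear] with t ht
      have := congrArg ev (hsol _ ht)
      simpa [φ, g, ev] using this
    · have hφ : ∀ s ∈ Icc (0 : ℝ) 1, φ (s * (2 * t), x) = x + (2 * t) •
          ∫ r in (0 : ℝ)..s, f (S (2 * t, x) (projIcc 0 1 zero_le_one r)) := by
        intro s hs
        have h1 := hscale (2 * t, x) hp2 ⟨s, hs⟩ 1
        have h2 := congrArg (fun w : C(unitInterval, E) => w ⟨s, hs⟩) (hsol _ hp2)
        rw [mul_one] at h1
        simp only [φ, ev, ContinuousMap.evalCLM_apply] at h1 ⊢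
        rw [h1]
        exact h2
      have hc : Continuous fun r : ℝ => f (S (2 * t, x) (projIcc 0 1 zero_le_one r)) :=
        hf.continuous.comp (continuous_comp_projIcc _)
      have hd1 := ((hc.integral_hasStrictDerivAt 0 (1 / 2)).hasDerivAt.const_smul
        (2 * t)).const_add x
      have h2t : 2 * t ≠ 0 := by simpa using ht
      have hdiv : HasDerivAt (fun σ : ℝ => σ / (2 * t)) (1 / (2 * t)) t :=
        (hasDerivAt_id t).div_const _
      have hhalf : t / (2 * t) = 1 / 2 := by field_simp
      have hd2 := HasDerivAt.scomp t (hhalf.symm ▸ hd1) hdiv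
      have hval : f (S (2 * t, x) (projIcc 0 1 zero_le_one (1 / 2))) = f (φ (t, x)) := by
        have hm : (1 / 2 : ℝ) ∈ Icc (0 : ℝ) 1 := by norm_num
        have h1 := hscale (2 * t, x) hp2 ⟨1 / 2, hm⟩ 1
        rw [mul_one] at h1
        rw [projIcc_of_mem _ hm, ← h1]
        have : ((1 / 2 : ℝ) * (2 * t), x) = (t, x) := by rw [Prod.mk.injEq]; exact ⟨by ring, rfl⟩
        simp only [φ, ev, ContinuousMap.evalCLM_apply, this]
      rw [hhalf, hval, smul_smul, one_div, inv_mul_cancel₀ h2t, one_smul] at hd2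
      refine hd2.congr_of_eventuallyEq ?_
      have hnear : ∀ᶠ σ : ℝ in 𝓝 t, σ / (2 * t) ∈ Icc (0 : ℝ) 1 := by
        refine hdiv.continuousAt.eventually (Icc_mem_nhds ?_ ?_) <;> simp only [hhalf] <;> norm_num
      filter_upwards [hnear] with σ hσ
      have := hφ _ hσ
      rw [div_mul_cancel₀ _ h2t] at this
      exact this

end Flow

/-! ### Straightening one and two vector fields -/

section FlowBox

variable {E : Type*} [NormedAddCommGroup E] [NormedSpace ℝ E]

/-- If `e` is a local inverse of `f`, then its differential inverts the differential of `f`. -/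
theorem fderiv_symm_apply_fderiv {F : Type*} [NormedAddCommGroup F] [NormedSpace ℝ F]
    (e : OpenPartialHomeomorph E F) {x : E} (hx : x ∈ e.source) (he : DifferentiableAt ℝ e x)
    (hes : DifferentiableAt ℝ e.symm (e x)) (v : E) :
    fderiv ℝ e.symm (e x) (fderiv ℝ e x v) = v := by
  have h1 : HasFDerivAt (e.symm ∘ e) ((fderiv ℝ e.symm (e x)).comp (fderiv ℝ e x)) x :=
    hes.hasFDerivAt.comp x he.hasFDerivAt
  have h2 : HasFDerivAt (e.symm ∘ e) (ContinuousLinearMap.id ℝ E) x :=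
    (hasFDerivAt_id x).congr_of_eventuallyEq (e.eventually_left_inverse hx)
  exact congrArg (fun T : E →L[ℝ] E => T v) (h1.unique h2)

/-- A function whose derivative in the direction `v` vanishes near `z` does not change, near `z`,
under projection along `v` to a hyperplane through `z`. -/
theorem eventually_eq_comp_projection {F : Type*} [NormedAddCommGroup F] [NormedSpace ℝ F]
    {f : E → F} {z v : E} (l : E →L[ℝ] ℝ)
    (hf : ∀ᶠ w in 𝓝 z, DifferentiableAt ℝ f w ∧ fderiv ℝ f w v = 0) :
    ∀ᶠ w in 𝓝 z, f (w - l (w - z) • v) = f w := by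
  obtain ⟨r, hr, H⟩ := Metric.eventually_nhds_iff_ball.1 hf
  have hc : Continuous fun w => w - l (w - z) • v := by fun_prop
  have h1 : ∀ᶠ w in 𝓝 z, w - l (w - z) • v ∈ Metric.ball z r :=
    hc.continuousAt.eventually (Metric.isOpen_ball.mem_nhds (by simpa using hr))
  filter_upwards [h1, Metric.ball_mem_nhds z hr] with w hw hwr
  let γ : ℝ → E := fun t => w - t • l (w - z) • v
  have hγ : ∀ t ∈ Icc (0 : ℝ) 1, γ t ∈ Metric.ball z r := by
    intro t ht
    refine (convex_ball z r).segment_subset hwr hw ?_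
    rw [segment_eq_image']
    exact ⟨t, ht, by simp [γ, sub_eq_add_neg]⟩
  have hd : ∀ t ∈ Icc (0 : ℝ) 1, HasDerivAt (f ∘ γ) 0 t := by
    intro t ht
    have h2 : HasDerivAt γ (-(l (w - z) • v)) t := by
      simpa [γ] using ((hasDerivAt_id t).smul_const (l (w - z) • v)).const_sub w
    have h3 := (H _ (hγ t ht)).1.hasFDerivAt.comp_hasDerivAt t h2
    rwa [map_neg, map_smul, (H _ (hγ t ht)).2, smul_zero, neg_zero] at h3
  have := constant_of_has_deriv_right_zero (f := f ∘ γ) (a := 0) (b := 1)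
    (fun t ht => (hd t ht).continuousAt.continuousWithinAt)
    (fun t ht => (hd t ⟨ht.1, ht.2.le⟩).hasDerivWithinAt) 1 (by simp)
  simpa [γ] using this

variable [FiniteDimensional ℝ E]

/-- Near a point where it does not vanish, a smooth vector field is carried to a constant one by
a smooth map which is tangent to the identity. -/
theorem exists_flow_box {X : E → E} (hX : ContDiff ℝ ∞ X) {z : E} (hz : X z ≠ 0) :
    ∃ G : E → E, ContDiff ℝ ∞ G ∧ G z = z ∧ HasFDerivAt G (ContinuousLinearMap.id ℝ E) z ∧
      ∀ᶠ w in 𝓝 z, fderiv ℝ G w (X w) = X z := by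
  have := FiniteDimensional.complete ℝ E
  obtain ⟨φ, U, hU, hzU, hφ, hφ0, hφX⟩ := exists_smooth_flow hX z
  obtain ⟨l, hl⟩ := SeparatingDual.exists_eq_one (R := ℝ) hz
  -- `y` is split into a time `l (y - z)` and a point of the hyperplane through `z` parallel to the
  -- kernel of `l`. Flowing that point for that time, `φ ∘ ψ` has identity differential at `z` and
  -- carries the constant field `X z` to `X`; `G` is its local inverse.
  let ψ : E → ℝ × E := fun y => (l (y - z), y - l (y - z) • X z)
  have hψ : ContDiff ℝ ∞ ψ := by fun_prop
  have hψz : ψ z = (0, z) := by simp [ψ]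
  have hψ' : ∀ y, HasFDerivAt ψ
      (l.prod (ContinuousLinearMap.id ℝ E - l.smulRight (X z))) y := by
    intro y
    have h1 : HasFDerivAt (fun y => l (y - z)) l y :=
      (l.hasFDerivAt.comp y ((hasFDerivAt_id y).sub_const z)).congr_fderiv (by ext; rfl)
    exact h1.prodMk ((hasFDerivAt_id y).sub (h1.smul_const (X z)))
  have hφ' : ∀ p ∈ U, HasFDerivAt φ (fderiv ℝ φ p) p := fun p hp =>
    ((hφ.contDiffAt (hU.mem_nhds hp)).differentiableAt (by simp)).hasFDerivAt
  have ht : ∀ p ∈ U, fderiv ℝ φ p (1, 0) = X (φ p) := by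
    intro p hp
    have h1 : HasDerivAt (fun t : ℝ => (t, p.2)) (1, 0) p.1 :=
      (hasDerivAt_id p.1).prodMk (hasDerivAt_const p.1 p.2)
    exact (HasFDerivAt.comp_hasDerivAt p.1 (hφ' p hp) h1).unique (hφX p hp)
  have hx : ∀ v : E, fderiv ℝ φ (0, z) (0, v) = v := by
    intro v
    have h1 : HasFDerivAt (fun x : E => ((0 : ℝ), x)) _ z :=
      (ContinuousLinearMap.inr ℝ ℝ E).hasFDerivAt
    have h2 := (hφ' _ hzU).comp z h1
    have h3 : HasFDerivAt (φ ∘ fun x : E => ((0 : ℝ), x)) (ContinuousLinearMap.id ℝ E) z := by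
      refine (hasFDerivAt_id z).congr_of_eventuallyEq ?_
      have : ∀ᶠ x in 𝓝 z, ((0 : ℝ), x) ∈ U :=
        (Continuous.prodMk_right (0 : ℝ)).continuousAt.eventually (hU.mem_nhds hzU)
      filter_upwards [this] with x hx using hφ0 x hx
    exact congrArg (fun T : E →L[ℝ] E => T v) (h2.unique h3)
  have hU' : IsOpen (ψ ⁻¹' U) := hU.preimage hψ.continuous
  have hzU' : z ∈ ψ ⁻¹' U := by rwa [mem_preimage, hψz]
  have hΨ : ContDiffOn ℝ ∞ (φ ∘ ψ) (ψ ⁻¹' U) := hφ.comp hψ.contDiffOn fun _ hy => hy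
  have hΨ' : ∀ y ∈ ψ ⁻¹' U, HasFDerivAt (φ ∘ ψ) ((fderiv ℝ φ (ψ y)).comp
      (l.prod (ContinuousLinearMap.id ℝ E - l.smulRight (X z)))) y := fun y hy =>
    (hφ' _ hy).comp y (hψ' y)
  have hid : HasFDerivAt (φ ∘ ψ) (ContinuousLinearMap.id ℝ E) z := by
    refine (hΨ' z hzU').congr_fderiv ?_
    ext v
    have : (l v, v - l v • X z) = l v • ((1 : ℝ), (0 : E)) + (0, v - l v • X z) := by simp
    simp only [ContinuousLinearMap.comp_apply, ContinuousLinearMap.prod_apply, hψz,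
      sub_apply, ContinuousLinearMap.id_apply,
      ContinuousLinearMap.smulRight_apply]
    rw [this, map_add, map_smul, ht _ hzU, hx, hφ0 z hzU]
    abel
  have hstr : ∀ y ∈ ψ ⁻¹' U, fderiv ℝ (φ ∘ ψ) y (X z) = X (φ (ψ y)) := by
    intro y hy
    rw [(hΨ' y hy).fderiv]
    simp [hl, ht _ hy]
  obtain ⟨e, he, hze, heU, hes⟩ := exists_smooth_local_inverse hU' hΨ hzU'
    (f' := ContinuousLinearEquiv.refl ℝ E) hid
  have hez : e z = z := by
    rw [he, Function.comp_apply, hψz, hφ0 z hzU]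
  have hzt : z ∈ e.target := by
    have := e.map_source hze
    rwa [hez] at this
  have hesz : e.symm z = z := by
    have := e.left_inv hze
    rwa [hez] at this
  have hesd : ∀ w ∈ e.target, DifferentiableAt ℝ e.symm w := fun w hw =>
    (hes.contDiffAt (e.open_target.mem_nhds hw)).differentiableAt (by simp)
  have hed : ∀ y ∈ e.source, DifferentiableAt ℝ e y := fun y hy =>
    he ▸ (hΨ' y (heU hy)).differentiableAt
  have hinv : ∀ w ∈ e.target, ∀ v, fderiv ℝ e.symm w (fderiv ℝ e (e.symm w) v) = v := by
    intro w hw v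
    have h1 := fderiv_symm_apply_fderiv e (e.map_target hw) (hed _ (e.map_target hw))
      (by rw [e.right_inv hw]; exact hesd w hw) v
    rwa [e.right_inv hw] at h1
  obtain ⟨G, hG, hGe⟩ := exists_contDiff_eventuallyEq e.open_target hes hzt
  refine ⟨G, hG, by rw [hGe.eq_of_nhds, hesz], ?_, ?_⟩
  · refine HasFDerivAt.congr_of_eventuallyEq ?_ hGe
    refine (hesd z hzt).hasFDerivAt.congr_fderiv ?_
    ext v
    have := hinv z hzt v
    rwa [hesz, he, hid.fderiv] at this
  · filter_upwards [hGe.fderiv (𝕜 := ℝ), e.open_target.mem_nhds hzt] with w hw hwt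
    rw [hw]
    have h1 := hinv w hwt (X z)
    have h2 := hstr _ (heU (e.map_target hwt))
    have h3 : φ (ψ (e.symm w)) = w := by
      have := e.right_inv hwt
      rwa [he] at this
    rwa [he, h2, h3] at h1

/-- Let `G` straighten the vector field `X` near `z`, and let `Y` be a vector field which in the
straightened picture is invariant along `X` and tangent to the level sets of `l`. Then there is a
smooth map which is constant along `X` and straightens `Y`. -/
theorem exists_common_straightening {X Y G : E → E} {z : E} {U : Set E} (hU : IsOpen U)
    (hz : z ∈ U) (hY : ContDiffOn ℝ ∞ Y U) (hYz : Y z ≠ 0) (hG : ContDiff ℝ ∞ G) (hGz : G z = z)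
    (hGid : HasFDerivAt G (ContinuousLinearMap.id ℝ E) z) (l : E →L[ℝ] ℝ) (hl : l (X z) = 1)
    (hGX : ∀ w ∈ U, fderiv ℝ G w (X w) = X z) (hlY : ∀ w ∈ U, l (fderiv ℝ G w (Y w)) = 0)
    (hinv : ∀ w ∈ U, fderiv ℝ (fun y => fderiv ℝ G y (Y y)) w (X w) = 0) :
    ∃ R : E → E, ContDiff ℝ ∞ R ∧
      HasFDerivAt R (ContinuousLinearMap.id ℝ E - l.smulRight (X z)) z ∧
      ∀ᶠ w in 𝓝 z, fderiv ℝ R w (X w) = 0 ∧ fderiv ℝ R w (Y w) = Y z := by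
  have := FiniteDimensional.complete ℝ E
  obtain ⟨e, he, hze, heU, hes⟩ := exists_smooth_local_inverse hU hG.contDiffOn hz
    (f' := ContinuousLinearEquiv.refl ℝ E) hGid
  have hez : e z = z := by rw [he, hGz]
  have hzt : z ∈ e.target := by
    have := e.map_source hze
    rwa [hez] at this
  have hesz : e.symm z = z := by
    have := e.left_inv hze
    rwa [hez] at this
  have hGd : ∀ w, DifferentiableAt ℝ G w := fun w => (hG.differentiable (by simp)).differentiableAt
  have hesd : ∀ w ∈ e.target, DifferentiableAt ℝ e.symm w := fun w hw =>
    (hes.contDiffAt (e.open_target.mem_nhds hw)).differentiableAt (by simp)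
  have hGY : ContDiffOn ℝ ∞ (fun y => fderiv ℝ G y (Y y)) U :=
    (hG.fderiv_right (m := ∞) le_rfl).contDiffOn.clm_apply hY
  -- This is the push-forward of `Y` under `G`. By `hinv` it does not vary in the direction `X z`.
  have hY1 : ContDiffOn ℝ ∞ (fun w => fderiv ℝ G (e.symm w) (Y (e.symm w))) e.target :=
    hGY.comp hes fun w hw => heU (e.map_target hw)
  obtain ⟨Y₁, hY₁, hY₁e⟩ := exists_contDiff_eventuallyEq e.open_target hY1 hzt
  have hY₁z : Y₁ z = Y z := by
    rw [hY₁e.eq_of_nhds, hesz, hGid.fderiv]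
    rfl
  have hinv₁ : ∀ᶠ w in 𝓝 z, DifferentiableAt ℝ Y₁ w ∧ fderiv ℝ Y₁ w (X z) = 0 := by
    filter_upwards [hY₁e.fderiv (𝕜 := ℝ), e.open_target.mem_nhds hzt] with w hw hwt
    refine ⟨(hY₁.differentiable (by simp)).differentiableAt, ?_⟩
    have hsU := heU (e.map_target hwt)
    have h1 : HasFDerivAt (fun w => fderiv ℝ G (e.symm w) (Y (e.symm w))) _ w :=
      HasFDerivAt.comp w ((hGY.contDiffAt (hU.mem_nhds hsU)).differentiableAt
        (by simp)).hasFDerivAt (hesd w hwt).hasFDerivAt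
    have h2 := fderiv_symm_apply_fderiv e (e.map_target hwt) (he ▸ hGd _)
      (by rw [e.right_inv hwt]; exact hesd w hwt) (X (e.symm w))
    rw [e.right_inv hwt, he, hGX _ hsU] at h2
    rw [hw, h1.fderiv, ContinuousLinearMap.comp_apply, h2, hinv _ hsU]
  -- The map sought is `H ∘ π ∘ G`, with `H` straightening `Y₁`. The projection `π` along `X z`
  -- kills the straightened `X`. It fixes the vectors `Y₁`, which `l` annihilates, and `Y₁` takes
  -- equal values at a point and at its projection, so `H` still straightens it after projecting.
  let π : E → E := fun w => w - l (w - z) • X z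
  let π' : E →L[ℝ] E := ContinuousLinearMap.id ℝ E - l.smulRight (X z)
  have hπ : ∀ w, HasFDerivAt π π' w := by
    intro w
    have h1 : HasFDerivAt (fun y => l (y - z)) l w :=
      (l.hasFDerivAt.comp w ((hasFDerivAt_id w).sub_const z)).congr_fderiv (by ext; rfl)
    exact (hasFDerivAt_id w).sub (h1.smul_const (X z))
  have hπs : ContDiff ℝ ∞ π := by fun_prop
  have hπz : π z = z := by simp [π]
  have hproj : ∀ᶠ w in 𝓝 z, Y₁ (π w) = Y₁ w := eventually_eq_comp_projection l hinv₁
  obtain ⟨H, hH, -, hHid, hHY⟩ := exists_flow_box hY₁ (z := z) (by rwa [hY₁z])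
  have hHd : ∀ w, DifferentiableAt ℝ H w := fun w => (hH.differentiable (by simp)).differentiableAt
  have hR : ∀ w, HasFDerivAt (H ∘ π ∘ G)
      ((fderiv ℝ H (π (G w))).comp (π'.comp (fderiv ℝ G w))) w := fun w =>
    (hHd _).hasFDerivAt.comp w ((hπ _).comp w (hGd w).hasFDerivAt)
  refine ⟨H ∘ π ∘ G, hH.comp (hπs.comp hG), ?_, ?_⟩
  · refine (hR z).congr_fderiv ?_
    rw [hGz, hπz, hHid.fderiv, hGid.fderiv]
    rfl
  · have hGc : Tendsto G (𝓝 z) (𝓝 z) := by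
      simpa [hGz] using hG.continuous.tendsto z
    have hπc : Tendsto π (𝓝 z) (𝓝 z) := by
      simpa only [hπz] using hπs.continuous.tendsto z
    filter_upwards [hU.mem_nhds hz, e.open_source.mem_nhds hze, hGc.eventually hY₁e,
      hGc.eventually hproj, hGc.eventually (hπc.eventually hHY)] with w hwU hws hw1 hw2 hw3
    rw [(hR w).fderiv]
    simp only [ContinuousLinearMap.comp_apply]
    constructor
    · rw [hGX w hwU]
      simp [π', hl]
    · have h1 : e.symm (G w) = w := by rw [← he]; exact e.left_inv hws
      have h2 : π' (fderiv ℝ G w (Y w)) = fderiv ℝ G w (Y w) := by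
        simp [π', hlY w hwU]
      rw [h1] at hw1
      rw [h2, ← hw1, ← hw2, hw3, hY₁z]

end FlowBox

/-! ### Hamiltonian vector fields and consequences of the Jacobi identity -/

section Brackets

variable {N : ℕ} {J : Phase N → Matrix (Fin N) (Fin N) ℝ} {V : Set (Phase N)}

theorem fderiv_eq_sum_pderiv (A : Phase N → ℝ) (z v : Phase N) :
    fderiv ℝ A z v = ∑ i, v i * pderiv i A z := by
  conv_lhs => rw [pi_eq_sum_univ' v]
  simp [pderiv, map_sum]

theorem _root_.Filter.EventuallyEq.pderiv {A B : Phase N → ℝ} {z : Phase N} (h : A =ᶠ[𝓝 z] B)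
    (i : Fin N) : pderiv i A =ᶠ[𝓝 z] pderiv i B := by
  filter_upwards [h.fderiv (𝕜 := ℝ)] with w hw
  simp only [Nambu.pderiv, hw]

theorem contDiffOn_pderiv (hV : IsOpen V) {A : Phase N → ℝ} (hA : IsObservable V A) (i : Fin N) :
    IsObservable V (pderiv i A) :=
  (hA.fderiv_of_isOpen (m := ∞) hV le_rfl).clm_apply contDiffOn_const

theorem IsObservable.differentiableAt (hV : IsOpen V) {A : Phase N → ℝ} (hA : IsObservable V A)
    {z : Phase N} (hz : z ∈ V) : DifferentiableAt ℝ A z :=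
  (hA.contDiffAt (hV.mem_nhds hz)).differentiableAt (by simp)

/-- The Hamiltonian vector field of `A`, characterised by `{A, B} = dB (hamiltonian A)`. -/
noncomputable def hamiltonian (J : Phase N → Matrix (Fin N) (Fin N) ℝ) (A : Phase N → ℝ) :
    Phase N → Phase N :=
  fun z j => ∑ i, J z i j * pderiv i A z

theorem poissonBracket_eq_fderiv (A B : Phase N → ℝ) (z : Phase N) :
    poissonBracket J A B z = fderiv ℝ B z (hamiltonian J A z) := by
  rw [fderiv_eq_sum_pderiv, poissonBracket, Finset.sum_comm]
  simp only [hamiltonian, Finset.sum_mul]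

theorem contDiffOn_hamiltonian (hV : IsOpen V) (hJ : IsPoissonOn V J) {A : Phase N → ℝ}
    (hA : IsObservable V A) : ContDiffOn ℝ ∞ (hamiltonian J A) V :=
  contDiffOn_pi.2 fun j => ContDiffOn.sum fun i _ =>
    (hJ.smooth i j).mul (contDiffOn_pderiv hV hA i)

theorem poissonBracket_skew (hJ : IsPoissonOn V J) {z : Phase N} (hz : z ∈ V)
    (A B : Phase N → ℝ) : poissonBracket J A B z = -poissonBracket J B A z := by
  rw [poissonBracket, Finset.sum_comm, poissonBracket, ← Finset.sum_neg_distrib]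
  refine Finset.sum_congr rfl fun i _ => ?_
  rw [← Finset.sum_neg_distrib]
  refine Finset.sum_congr rfl fun j _ => ?_
  rw [hJ.skew z hz j i]
  ring

theorem poissonBracket_self (hJ : IsPoissonOn V J) {z : Phase N} (hz : z ∈ V)
    (A : Phase N → ℝ) : poissonBracket J A A z = 0 := by
  have := poissonBracket_skew hJ hz A A
  linarith

theorem poissonBracket_eq_zero_of_eventually_const {A B : Phase N → ℝ} {z : Phase N} {c : ℝ}
    (h : ∀ᶠ w in 𝓝 z, A w = c) : poissonBracket J A B z = 0 := by
  have h1 : ∀ i, pderiv i A z = 0 := fun i => by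
    have h2 : A =ᶠ[𝓝 z] fun _ => c := h
    rw [(h2.pderiv i).eq_of_nhds]
    simp [pderiv]
  simp [poissonBracket, h1]

/-- If `{C, A}` and `{C, B}` are locally constant then `{A, B}` is invariant under the Hamiltonian
vector field of `C`. -/
theorem poissonBracket_bracket_eq_zero (hJ : IsPoissonOn V J)
    {A B C : Phase N → ℝ} (hA : IsObservable V A) (hB : IsObservable V B) (hC : IsObservable V C)
    {U : Set (Phase N)} (hU : IsOpen U) (hUV : U ⊆ V) {a b : ℝ}
    (ha : ∀ w ∈ U, poissonBracket J C A w = a) (hb : ∀ w ∈ U, poissonBracket J C B w = b)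
    {z : Phase N} (hz : z ∈ U) : poissonBracket J C (poissonBracket J A B) z = 0 := by
  have h1 := hJ.jacobi A B C hA hB hC z (hUV hz)
  have h2 : poissonBracket J (poissonBracket J B C) A z = 0 := by
    refine poissonBracket_eq_zero_of_eventually_const (c := -b) ?_
    filter_upwards [hU.mem_nhds hz] with w hw
    rw [poissonBracket_skew hJ (hUV hw), hb w hw]
  have h3 : poissonBracket J (poissonBracket J C A) B z = 0 := by
    refine poissonBracket_eq_zero_of_eventually_const (c := a) ?_
    filter_upwards [hU.mem_nhds hz] with w hw using ha w hw
  rw [poissonBracket_skew hJ (hUV hz)]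
  linarith

end Brackets

/-! ### Darboux's theorem in rank two -/

/-- A matrix of rank at most `2` with a `2 × 2` block `(0, 1; -1, 0)` that is decoupled from
the other indices has no further nonzero entry. -/
theorem eq_zero_of_rank_le_two {n : Type*} [Fintype n] [DecidableEq n] {B : Matrix n n ℝ}
    (hB : B.rank ≤ 2) {p q i j : n} (hpp : B p p = 0) (hqq : B q q = 0) (hpq : B p q = 1)
    (hqp : B q p = -1) (hip : B i p = 0) (hiq : B i q = 0) (hpj : B p j = 0) (hqj : B q j = 0) :
    B i j = 0 := by
  by_contra h
  -- The columns are taken in the order `q, p, j` so that this 3 × 3 block is diagonal; a nonzero `B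
  -- i j` would make it invertible, of rank 3.
  let S : Matrix (Fin 3) (Fin 3) ℝ := B.submatrix ![p, q, i] ![q, p, j]
  have hS : S = Matrix.diagonal ![1, -1, B i j] := by
    refine Matrix.ext fun a b => ?_
    fin_cases a <;> fin_cases b
    exacts [hpq, hpp, hpj, hqq, hqp, hqj, hiq, hip, rfl]
  have h1 : S.rank ≤ B.rank := by
    have : S = Matrix.of (fun a m => if ![p, q, i] a = m then (1 : ℝ) else 0) *
        (B * Matrix.of fun m b => if m = ![q, p, j] b then (1 : ℝ) else 0) := by
      refine Matrix.ext fun a b => ?_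
      simp only [S, Matrix.mul_apply, Matrix.of_apply, Matrix.submatrix_apply, ite_mul, one_mul,
        zero_mul, mul_ite, mul_one, mul_zero, Finset.sum_ite_eq, Finset.sum_ite_eq',
        Finset.mem_univ, if_true]
    rw [this]
    exact (Matrix.rank_mul_le_right _ _).trans (Matrix.rank_mul_le_left _ _)
  have h2 : IsUnit S := by
    rw [hS, Matrix.isUnit_iff_isUnit_det, Matrix.det_diagonal]
    simp [Fin.prod_univ_three, h]
  have h3 := Matrix.rank_of_isUnit S h2
  rw [Fintype.card_fin] at h3
  omega

theorem darbouxMatrix_one_apply {N : ℕ} (i j : Fin N) : darbouxMatrix N 1 i j =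
    if (i : ℕ) = 0 ∧ (j : ℕ) = 1 then 1 else if (j : ℕ) = 0 ∧ (i : ℕ) = 1 then -1 else 0 := by
  have h1 : (i : ℕ) < 1 ∧ (j : ℕ) = i + 1 ↔ (i : ℕ) = 0 ∧ (j : ℕ) = 1 := by omega
  have h2 : (j : ℕ) < 1 ∧ (i : ℕ) = j + 1 ↔ (j : ℕ) = 0 ∧ (i : ℕ) = 1 := by omega
  simp only [darbouxMatrix, h1, h2]

/-- The matrix of brackets of `h` is congruent to `J`, up to a possibly degenerate matrix. -/
theorem rank_changeMatrix_le {N : ℕ} (h g : Phase N → Phase N)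
    (J : Phase N → Matrix (Fin N) (Fin N) ℝ) (x : Phase N) :
    (changeMatrix h g J x).rank ≤ (J (g x)).rank := by
  let D : Matrix (Fin N) (Fin N) ℝ := fun i m => pderiv m (fun z => h z i) (g x)
  have : changeMatrix h g J x = D * (J (g x) * D.transpose) := by
    refine Matrix.ext fun i j => ?_
    rw [Matrix.mul_apply]
    simp only [Matrix.mul_apply, Matrix.transpose_apply, Finset.mul_sum]
    exact Finset.sum_congr rfl fun _ _ => Finset.sum_congr rfl fun _ _ => by ring
  rw [this]
  exact (Matrix.rank_mul_le_right _ _).trans (Matrix.rank_mul_le_left _ _)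

/-- A two-dimensional subspace is the kernel of a linear map onto the remaining coordinates. -/
theorem exists_linearMap_ker_span_pair {K : ℕ} {E : Type*} [AddCommGroup E] [Module ℝ E]
    [FiniteDimensional ℝ E] (hE : Module.finrank ℝ E = K + 2) {u v : E}
    (huv : LinearIndependent ℝ ![u, v]) :
    ∃ μ : E →ₗ[ℝ] (Fin K → ℝ), LinearMap.ker μ = Submodule.span ℝ {u, v} := by
  let S := Submodule.span ℝ (Set.range ![u, v])
  have h1 : Module.finrank ℝ S = 2 := by
    rw [finrank_span_eq_card huv, Fintype.card_fin]
  have h2 : Module.finrank ℝ (E ⧸ S) = Module.finrank ℝ (Fin K → ℝ) := by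
    have := S.finrank_quotient_add_finrank
    rw [Module.finrank_fin_fun]
    omega
  refine ⟨(LinearEquiv.ofFinrankEq _ _ h2).toLinearMap ∘ₗ S.mkQ, ?_⟩
  rw [LinearEquiv.ker_comp, Submodule.ker_mkQ]
  simp only [S, Matrix.range_cons, Matrix.range_empty, union_empty, singleton_union]

/-- **Darboux's theorem** for Poisson brackets of rank two. -/
theorem exists_darbouxChart {K : ℕ} {Ω : Set (Phase (K + 2))} (hΩ : IsOpen Ω)
    {J : Phase (K + 2) → Matrix (Fin (K + 2)) (Fin (K + 2)) ℝ} (hJ : IsPoissonOn Ω J)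
    (hrank : ∀ z ∈ Ω, (J z).rank = 2) {z : Phase (K + 2)} (hz : z ∈ Ω) :
    ∃ h : OpenPartialHomeomorph (Phase (K + 2)) (Phase (K + 2)),
      z ∈ h.source ∧ h.source ⊆ Ω ∧ IsDarbouxChart 1 h J := by
  obtain ⟨q, r, hqr⟩ : ∃ q r, J z q r ≠ 0 := by
    by_contra! H
    have : J z = 0 := by ext i j; exact H i j
    have h2 := hrank z hz
    rw [this, Matrix.rank_zero] at h2
    omega
  -- The first Darboux coordinate: row `q` of `J z` is nonzero, so the Hamiltonian field of `Q` does
  -- not vanish at `z`.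
  let Q : Phase (K + 2) → ℝ := fun w => w q
  have hQ : ContDiff ℝ ∞ Q := contDiff_apply ℝ ℝ q
  have hQ' : ∀ w v, fderiv ℝ Q w v = v q := fun w v =>
    congrArg (fun T : Phase (K + 2) →L[ℝ] ℝ => T v)
      (ContinuousLinearMap.proj (R := ℝ) (φ := fun _ : Fin (K + 2) => ℝ) q).hasFDerivAt.fderiv
  let X := hamiltonian J Q
  have hX : ContDiffOn ℝ ∞ X Ω := contDiffOn_hamiltonian hΩ hJ hQ.contDiffOn
  have hXz : X z ≠ 0 := by
    intro h0
    have h1 := congrFun h0 r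
    simp only [X, hamiltonian, pderiv, hQ', Pi.zero_apply, Pi.single_apply] at h1
    simp only [mul_ite, mul_one, mul_zero, Finset.sum_ite_eq, Finset.mem_univ, if_true] at h1
    exact hqr h1
  obtain ⟨X₁, hX₁, hX₁e⟩ := exists_contDiff_eventuallyEq hΩ hX hz
  have hX₁z : X₁ z = X z := hX₁e.eq_of_nhds
  obtain ⟨G, hG, hGz, hGid, hGX₁⟩ := exists_flow_box hX₁ (z := z) (hX₁z ▸ hXz)
  have hGX : ∀ᶠ w in 𝓝 z, fderiv ℝ G w (X w) = X z := by
    filter_upwards [hGX₁, hX₁e] with w h1 h2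
    rw [← h2, h1, hX₁z]
  obtain ⟨U, hUs, hU, hzU⟩ := eventually_nhds_iff.1 (hGX.and (hΩ.eventually_mem hz))
  have hUΩ : U ⊆ Ω := fun w hw => (hUs w hw).2
  have hGd : ∀ w, DifferentiableAt ℝ G w := fun w => (hG.differentiable (by simp)).differentiableAt
  obtain ⟨l, hl⟩ := SeparatingDual.exists_eq_one (R := ℝ) hXz
  -- Since `G` carries X to the constant `X z` and `l (X z) = 1`, this function satisfies {Q, P} = 1
  -- near `z`.
  let P : Phase (K + 2) → ℝ := fun w => l (G w)
  have hP : ContDiff ℝ ∞ P := l.contDiff.comp hG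
  have hP' : ∀ w v, fderiv ℝ P w v = l (fderiv ℝ G w v) := fun w v =>
    congrArg (fun T : Phase (K + 2) →L[ℝ] ℝ => T v)
      (l.hasFDerivAt.comp w (hGd w).hasFDerivAt).fderiv
  have hGi : ∀ i w v, fderiv ℝ (fun y => G y i) w v = fderiv ℝ G w v i := fun i w v => by
    rw [fderiv_apply (hGd w) i]
    rfl
  have hQP : ∀ w ∈ U, poissonBracket J Q P w = 1 := by
    intro w hw
    rw [poissonBracket_eq_fderiv, hP', (hUs w hw).1, hl]
  let Y := hamiltonian J P
  have hY : ContDiffOn ℝ ∞ Y Ω := contDiffOn_hamiltonian hΩ hJ hP.contDiffOn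
  have hYq : Y z q = -1 := by
    rw [← hQ' z (Y z), ← poissonBracket_eq_fderiv, poissonBracket_skew hJ hz, hQP z hzU]
  have hlY : ∀ w ∈ U, l (fderiv ℝ G w (Y w)) = 0 := by
    intro w hw
    rw [← hP', ← poissonBracket_eq_fderiv, poissonBracket_self hJ (hUΩ hw)]
  have hGY : ContDiffOn ℝ ∞ (fun y => fderiv ℝ G y (Y y)) Ω :=
    (hG.fderiv_right (m := ∞) le_rfl).contDiffOn.clm_apply hY
  -- The components of the straightened Y are the brackets {P, G_i}. As {Q, P} and {Q, G_i} are
  -- constant on `U`, the Jacobi identity gives {Q, {P, G_i}} = 0.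
  have hinv : ∀ w ∈ U, fderiv ℝ (fun y => fderiv ℝ G y (Y y)) w (X w) = 0 := by
    intro w hw
    ext i
    have hd : DifferentiableAt ℝ (fun y => fderiv ℝ G y (Y y)) w :=
      (hGY.contDiffAt (hΩ.mem_nhds (hUΩ hw))).differentiableAt (by simp)
    have h1 : fderiv ℝ (fun y => fderiv ℝ G y (Y y)) w (X w) i =
        fderiv ℝ (fun y => fderiv ℝ G y (Y y) i) w (X w) := by
      rw [fderiv_apply hd i]
      rfl
    have h2 : (fun y => fderiv ℝ G y (Y y) i) = poissonBracket J P (fun y => G y i) := by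
      ext y
      rw [poissonBracket_eq_fderiv, hGi]
    rw [h1, h2, Pi.zero_apply, ← poissonBracket_eq_fderiv]
    refine poissonBracket_bracket_eq_zero hJ hP.contDiffOn
      (contDiff_pi.1 hG i).contDiffOn hQ.contDiffOn hU hUΩ hQP (b := X z i) (fun y hy => ?_) hw
    rw [poissonBracket_eq_fderiv, hGi]
    exact congrFun (hUs y hy).1 i
  have hYz : Y z ≠ 0 := fun h0 => by
    rw [h0, Pi.zero_apply] at hYq
    norm_num at hYq
  obtain ⟨R, hR, hRz, hRe⟩ := exists_common_straightening hU hzU (hY.mono hUΩ) hYz hG hGz hGid l hl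
    (fun w hw => (hUs w hw).1) hlY hinv
  have hRd : ∀ w, DifferentiableAt ℝ R w := fun w => (hR.differentiable (by simp)).differentiableAt
  have hXq : X z q = 0 := by
    rw [← hQ' z (X z), ← poissonBracket_eq_fderiv, poissonBracket_self hJ hz]
  have hlYz : l (Y z) = 0 := by
    have := hlY z hzU
    rwa [hGid.fderiv] at this
  have hind : LinearIndependent ℝ ![Y z, X z] := by
    rw [LinearIndependent.pair_iff]
    intro a b hab
    have h1 := congrArg l hab
    have h2 := congrFun hab q
    simp only [map_add, map_smul, hlYz, hl, map_zero, smul_eq_mul] at h1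
    simp only [Pi.add_apply, Pi.smul_apply, hYq, hXq, Pi.zero_apply, smul_eq_mul] at h2
    constructor <;> linarith
  -- Near `z`, `R` sends X to 0 and Y to the constant `Y z`. Since `μ` kills `Y z`, the K functions
  -- `μ ∘ R` commute with Q and P. Its kernel is exactly the span of `Y z` and `X z`, where `q` and
  -- `l` are independent, so Q, P and `μ ∘ R` together form a chart.
  obtain ⟨μ₀, hμ₀⟩ := exists_linearMap_ker_span_pair (K := K) (by simp) hind
  let μ := LinearMap.toContinuousLinearMap μ₀
  have hμ : ∀ v, μ v = 0 ↔ ∃ a b : ℝ, a • Y z + b • X z = v := fun v => by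
    rw [← Submodule.mem_span_pair, ← hμ₀]
    rfl
  have hμY : μ (Y z) = 0 := (hμ _).2 ⟨1, 0, by simp⟩
  have hμX : μ (X z) = 0 := (hμ _).2 ⟨0, 1, by simp⟩
  let h : Phase (K + 2) → Phase (K + 2) := fun w => Fin.cons (Q w) (Fin.cons (P w) (μ (R w)))
  have hh0 : (fun w => h w 0) = Q := rfl
  have hh1 : (fun w => h w 1) = P := rfl
  have hhs : ∀ i : Fin K, (fun w => h w i.succ.succ) = fun w => μ (R w) i := fun i => rfl
  have hμR : ContDiff ℝ ∞ fun w => μ (R w) := μ.contDiff.comp hR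
  have hh : ContDiff ℝ ∞ h := by
    refine contDiff_pi.2 fun i => ?_
    refine Fin.cases hQ (fun i => ?_) i
    refine Fin.cases hP (fun i => ?_) i
    exact contDiff_pi.1 hμR i
  have hhd : ∀ w, DifferentiableAt ℝ h w := fun w => (hh.differentiable (by simp)).differentiableAt
  have hhi : ∀ i w v, fderiv ℝ (fun y => h y i) w v = fderiv ℝ h w v i := fun i w v => by
    rw [fderiv_apply (hhd w) i]
    rfl
  have hμRi : ∀ i w v, fderiv ℝ (fun y => μ (R y) i) w v = μ (fderiv ℝ R w v) i := by
    intro i w v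
    have h1 : HasFDerivAt (fun y => μ (R y)) (μ.comp (fderiv ℝ R w)) w :=
      μ.hasFDerivAt.comp w (hRd w).hasFDerivAt
    rw [fderiv_apply h1.differentiableAt i, h1.fderiv]
    rfl
  have hinj : Function.Injective (fderiv ℝ h z) := by
    rw [injective_iff_map_eq_zero]
    intro v hv
    have hv0 : v q = 0 := by
      rw [← hQ' z v, ← hh0, hhi, hv]
      rfl
    have hv1 : l v = 0 := by
      have h1 : fderiv ℝ P z v = 0 := by
        rw [← hh1, hhi, hv]
        rfl
      rwa [hP', hGid.fderiv] at h1
    have hv2 : μ v = 0 := by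
      ext i
      have h1 : fderiv ℝ (fun w => μ (R w) i) z v = 0 := by
        rw [← hhs, hhi, hv]
        rfl
      rw [hμRi, hRz.fderiv] at h1
      simpa [hv1] using h1
    obtain ⟨a, b, rfl⟩ := (hμ v).1 hv2
    simp only [map_add, map_smul, hlYz, hl, smul_eq_mul] at hv1
    simp only [Pi.add_apply, Pi.smul_apply, hYq, hXq, smul_eq_mul] at hv0
    have ha : a = 0 := by linarith
    have hb : b = 0 := by linarith
    simp [ha, hb]
  obtain ⟨W, hWs, hW, hzW⟩ := eventually_nhds_iff.1 (hRe.and (hU.eventually_mem hzU))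
  let h' : Phase (K + 2) ≃L[ℝ] Phase (K + 2) :=
    (LinearEquiv.ofInjectiveEndo (fderiv ℝ h z).toLinearMap hinj).toContinuousLinearEquiv
  have hh' : HasFDerivAt h (h' : Phase (K + 2) →L[ℝ] Phase (K + 2)) z :=
    (hhd z).hasFDerivAt.congr_fderiv (by ext; rfl)
  obtain ⟨e, he, hze, heW, hes⟩ := exists_smooth_local_inverse hW hh.contDiffOn hzW hh'
  have heΩ : e.source ⊆ Ω := fun w hw => hUΩ (hWs w (heW hw)).2
  refine ⟨e, hze, heΩ, he ▸ hh.contDiffOn, hes, fun x hx => ?_⟩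
  have hw := e.map_target hx
  set w := e.symm x with hwdef
  have hwΩ := heΩ hw
  let B := changeMatrix e e.symm J x
  have hB : ∀ i j, B i j = poissonBracket J (fun y => h y i) (fun y => h y j) w := by
    intro i j
    rw [← he]
    rfl
  have hBskew : ∀ i j, B i j = -B j i := fun i j => by
    rw [hB, hB, poissonBracket_skew hJ hwΩ]
  have hBrank : B.rank ≤ 2 := (rank_changeMatrix_le _ _ _ _).trans (hrank _ hwΩ).le
  have h01 : B 0 1 = 1 := by
    rw [hB, hh0, hh1]
    exact hQP w (hWs w (heW hw)).2
  have h00 : ∀ i, B i i = 0 := fun i => by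
    have := hBskew i i
    linarith
  have h10 : B 1 0 = -1 := by rw [hBskew, h01]
  have h0s : ∀ i : Fin K, B 0 i.succ.succ = 0 := by
    intro i
    rw [hB, hh0, hhs, poissonBracket_eq_fderiv, hμRi, (hWs w (heW hw)).1.1, map_zero]
    rfl
  have h1s : ∀ i : Fin K, B 1 i.succ.succ = 0 := by
    intro i
    rw [hB, hh1, hhs, poissonBracket_eq_fderiv, hμRi, (hWs w (heW hw)).1.2, hμY]
    rfl
  have hs0 : ∀ i : Fin K, B i.succ.succ 0 = 0 := fun i => by rw [hBskew, h0s, neg_zero]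
  have hs1 : ∀ i : Fin K, B i.succ.succ 1 = 0 := fun i => by rw [hBskew, h1s, neg_zero]
  -- Only here does the rank bound enter: the block of Q and P already exhausts rank 2.
  have hss : ∀ i j : Fin K, B i.succ.succ j.succ.succ = 0 := fun i j =>
    eq_zero_of_rank_le_two hBrank (h00 0) (h00 1) h01 h10 (hs0 i) (hs1 i) (h0s j) (h1s j)
  change B = _
  ext i j
  rw [darbouxMatrix_one_apply]
  refine Fin.cases ?_ (fun i => Fin.cases ?_ (fun i => ?_) i) i <;>
    refine Fin.cases ?_ (fun j => Fin.cases ?_ (fun j => ?_) j) j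
  · simp [h00]
  · simp [h01]
  · simp [h0s]
  · simp [h10]
  · simp [h00]
  · simp [h1s]
  · simp [hs0]
  · simp [hs1]
  · simp [hss]

/-! ### Algebra of tri-linear brackets and the quadratic identity -/

section NambuBrackets

variable {N : ℕ} {L : Phase N → Fin N → Fin N → Fin N → ℝ} {V : Set (Phase N)}

theorem nambuBracket_congr {A A' B B' C C' : Phase N → ℝ} {z : Phase N} (hA : A =ᶠ[𝓝 z] A')
    (hB : B =ᶠ[𝓝 z] B') (hC : C =ᶠ[𝓝 z] C') :
    nambuBracket L A B C z = nambuBracket L A' B' C' z := by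
  simp only [nambuBracket, (hA.pderiv _).eq_of_nhds, (hB.pderiv _).eq_of_nhds,
    (hC.pderiv _).eq_of_nhds]

theorem isObservable_nambuBracket (hV : IsOpen V)
    (hL : ∀ i j k, ContDiffOn ℝ ∞ (fun z => L z i j k) V) {A B C : Phase N → ℝ}
    (hA : IsObservable V A) (hB : IsObservable V B) (hC : IsObservable V C) :
    IsObservable V (nambuBracket L A B C) :=
  ContDiffOn.sum fun i _ => ContDiffOn.sum fun j _ => ContDiffOn.sum fun k _ =>
    (((hL i j k).mul (contDiffOn_pderiv hV hA i)).mul (contDiffOn_pderiv hV hB j)).mul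
      (contDiffOn_pderiv hV hC k)

theorem nambuBracket_swap_left {z : Phase N} (h : ∀ i j k, L z i j k = -L z j i k)
    (A B C : Phase N → ℝ) : nambuBracket L A B C z = -nambuBracket L B A C z := by
  rw [nambuBracket, Finset.sum_comm, nambuBracket]
  simp only [← Finset.sum_neg_distrib]
  refine Finset.sum_congr rfl fun i _ => Finset.sum_congr rfl fun j _ =>
    Finset.sum_congr rfl fun k _ => ?_
  rw [h j i k]
  ring

theorem nambuBracket_swap_right {z : Phase N} (h : ∀ i j k, L z i j k = -L z i k j)
    (A B C : Phase N → ℝ) : nambuBracket L A B C z = -nambuBracket L A C B z := by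
  rw [nambuBracket, nambuBracket, ← Finset.sum_neg_distrib]
  refine Finset.sum_congr rfl fun i _ => ?_
  rw [Finset.sum_comm]
  simp only [← Finset.sum_neg_distrib]
  refine Finset.sum_congr rfl fun j _ => Finset.sum_congr rfl fun k _ => ?_
  rw [h i k j]
  ring

theorem nambuBracket_leibniz_middle {z : Phase N} (h : ∀ i j k, L z i j k = -L z j i k)
    (A B C D : Phase N → ℝ) (hB : DifferentiableAt ℝ B z) (hC : DifferentiableAt ℝ C z) :
    nambuBracket L A (fun y => B y * C y) D z
      = B z * nambuBracket L A C D z + nambuBracket L A B D z * C z := by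
  rw [nambuBracket_swap_left h, nambuBracket_leibniz L B C A D z hB hC,
    nambuBracket_swap_left h A C, nambuBracket_swap_left h A B]
  ring

theorem nambuBracket_leibniz_right {z : Phase N} (h : ∀ i j k, L z i j k = -L z j i k)
    (h' : ∀ i j k, L z i j k = -L z i k j)
    (A B C D : Phase N → ℝ) (hC : DifferentiableAt ℝ C z) (hD : DifferentiableAt ℝ D z) :
    nambuBracket L A B (fun y => C y * D y) z
      = C z * nambuBracket L A B D z + nambuBracket L A B C z * D z := by
  rw [nambuBracket_swap_right h', nambuBracket_leibniz_middle h A C D B hC hD,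
    nambuBracket_swap_right h' A B C, nambuBracket_swap_right h' A B D]
  ring

/-- The algebraic consequence of the fundamental identity: it forces the Plücker-type relation
between the brackets of any four observables in the presence of a fifth one. -/
theorem IsNambuOn.quadratic (hV : IsOpen V) (hL : IsNambuOn V L) {A B F G C : Phase N → ℝ}
    (hA : IsObservable V A) (hB : IsObservable V B) (hF : IsObservable V F)
    (hG : IsObservable V G) (hC : IsObservable V C) {z : Phase N} (hz : z ∈ V) :
    nambuBracket L A G C z * nambuBracket L B F C z
      - nambuBracket L B G C z * nambuBracket L A F C z
      + nambuBracket L F G C z * nambuBracket L A B C z = 0 := by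
  have hs := hL.skew_left
  have hs' := hL.skew_right
  have hzero : ∀ X : Phase N → ℝ, ∀ y ∈ V, nambuBracket L X C C y = 0 := fun X y hy => by
    have := nambuBracket_swap_right (hs' y hy) X C C
    linarith
  have hprod : ∀ X : Phase N → ℝ, ∀ y ∈ V, nambuBracket L X (fun y => G y * C y) C y =
      nambuBracket L X G C y * C y := fun X y hy => by
    rw [nambuBracket_leibniz_middle (hs y hy) X G C C (hG.differentiableAt hV hy)
      (hC.differentiableAt hV hy), hzero X y hy]
    ring
  have hprod' : ∀ X : Phase N → ℝ, nambuBracket L X (fun y => G y * C y) C =ᶠ[𝓝 z]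
      fun y => nambuBracket L X G C y * C y := fun X => by
    filter_upwards [hV.mem_nhds hz] with y hy using hprod X y hy
  have hd : ∀ X : Phase N → ℝ, IsObservable V X →
      DifferentiableAt ℝ (nambuBracket L X G C) z := fun X hX =>
    (isObservable_nambuBracket hV hL.smooth hX hG hC).differentiableAt hV hz
  have hCd := hC.differentiableAt hV hz
  -- Since {X, GC, C} = C {X, G, C}, the identity for `G * C` minus `C` times the identity for `G`
  -- retains only the terms where the Leibniz rule moves the bracket onto `C`.
  have h1 := hL.fundamental A B F (fun y => G y * C y) C hA hB hF (hG.mul hC) hC z hz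
  have h2 := hL.fundamental A B F G C hA hB hF hG hC z hz
  have hr : ∀ X : Phase N → ℝ, X =ᶠ[𝓝 z] X := fun _ => EventuallyEq.rfl
  rw [hprod _ z hz, nambuBracket_congr (hprod' A) (hr B) (hr F),
    nambuBracket_congr (hr A) (hprod' B) (hr F), nambuBracket_congr (hr A) (hr B) (hprod' F),
    nambuBracket_leibniz L _ C B F z (hd A hA) hCd,
    nambuBracket_leibniz_middle (hs z hz) A _ C F (hd B hB) hCd,
    nambuBracket_leibniz_right (hs z hz) (hs' z hz) A B _ C (hd F hF) hCd,
    nambuBracket_swap_left (hs z hz) C B F, nambuBracket_swap_right (hs' z hz) B C F,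
    nambuBracket_swap_right (hs' z hz) A C F] at h1
  linear_combination C z * h2 - h1

end NambuBrackets

/-! ### Quadratic relations and the rank bound -/

section Necessity

variable {N : ℕ} {J : Phase N → Matrix (Fin N) (Fin N) ℝ} {V : Set (Phase N)}

theorem pderiv_coordinate (i k : Fin N) (z : Phase N) :
    pderiv i (fun y : Phase N => y k) z = if k = i then 1 else 0 := by
  have h : HasFDerivAt (fun y : Phase N => y k)
      (ContinuousLinearMap.proj (R := ℝ) (φ := fun _ : Fin N => ℝ) k) z :=
    (ContinuousLinearMap.proj (R := ℝ) (φ := fun _ : Fin N => ℝ) k).hasFDerivAt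
  rw [pderiv, h.fderiv]
  simp [Pi.single_apply]

theorem isObservable_coordinate (V : Set (Phase N)) (k : Fin N) :
    IsObservable V (fun y : Phase N => y k) :=
  (contDiff_apply ℝ ℝ k).contDiffOn

theorem poissonBracket_coordinates (k l : Fin N) (z : Phase N) :
    poissonBracket J (fun y => y k) (fun y => y l) z = J z k l := by
  simp only [poissonBracket, pderiv_coordinate, mul_ite, mul_one, mul_zero, Finset.sum_ite_eq,
    Finset.mem_univ, if_true]

/-- The quadratic identity for four coordinate functions, with the generating function as fifth
observable: every bracket in it is then an entry of `J`, up to sign. -/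
theorem HasNambuBracketOn.quadraticRelations (hV : IsOpen V) (h : HasNambuBracketOn V J)
    (hJ : ∀ z ∈ V, ∀ i j, J z i j = -J z j i) {z : Phase N} (hz : z ∈ V) :
    QuadraticRelations (J z) := by
  obtain ⟨L, C, hL, hC, hgen⟩ := h
  intro i j k m
  have ho := fun a => isObservable_coordinate V (N := N) a
  have h1 := hL.quadratic hV (ho k) (ho i) (ho j) (ho m) hC hz
  rw [← hgen _ _ (ho k) (ho m) z hz, ← hgen _ _ (ho i) (ho j) z hz, ← hgen _ _ (ho i) (ho m) z hz,
    ← hgen _ _ (ho k) (ho j) z hz, ← hgen _ _ (ho j) (ho m) z hz,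
    ← hgen _ _ (ho k) (ho i) z hz] at h1
  simp only [poissonBracket_coordinates] at h1
  rw [hJ z hz k m, hJ z hz i m, hJ z hz j m, hJ z hz k j] at h1
  linear_combination -h1

/-- The quadratic relations force the rank to be at most two. -/
theorem QuadraticRelations.rank_le_two {P : Matrix (Fin N) (Fin N) ℝ} (h : QuadraticRelations P)
    (hP : ∀ i j, P i j = -P j i) : P.rank ≤ 2 := by
  by_cases h0 : ∀ i j, P i j = 0
  · have : P = 0 := Matrix.ext h0
    rw [this, Matrix.rank_zero]
    exact Nat.zero_le _
  · push Not at h0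
    obtain ⟨p, q, hpq⟩ := h0
    -- Dividing the relation for `p, q, k, m` by `P p q` writes column `k` as a combination of
    -- columns `p` and `q`, so `P` factors through a two-dimensional space.
    have : P = Matrix.of (fun m (a : Fin 2) => ![P m p, -P m q] a) *
        Matrix.of fun (a : Fin 2) k => ![P k q / P p q, P k p / P p q] a := by
      refine Matrix.ext fun m k => ?_
      have h1 := h p q k m
      rw [hP q k] at h1
      simp only [Matrix.mul_apply, Matrix.of_apply, Fin.sum_univ_two, Matrix.cons_val_zero,
        Matrix.cons_val_one]
      field_simp
      linear_combination h1
    rw [this]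
    exact (Matrix.rank_mul_le_left _ _).trans (Matrix.rank_le_width _)

end Necessity

/-! ### The Levi-Civita bracket and its fundamental identity -/

section LeviCivita

theorem leviCivitaTensor_apply (N : ℕ) (i j k : Fin N) : leviCivitaTensor N i j k =
    (if (i : ℕ) = 0 then 1 else 0) * (if (j : ℕ) = 1 then 1 else 0)
        * (if (k : ℕ) = N - 1 then 1 else 0)
      - (if (i : ℕ) = 0 then 1 else 0) * (if (j : ℕ) = N - 1 then 1 else 0)
        * (if (k : ℕ) = 1 then 1 else 0)
      - (if (i : ℕ) = 1 then 1 else 0) * (if (j : ℕ) = 0 then 1 else 0)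
        * (if (k : ℕ) = N - 1 then 1 else 0)
      + (if (i : ℕ) = 1 then 1 else 0) * (if (j : ℕ) = N - 1 then 1 else 0)
        * (if (k : ℕ) = 0 then 1 else 0)
      + (if (i : ℕ) = N - 1 then 1 else 0) * (if (j : ℕ) = 0 then 1 else 0)
        * (if (k : ℕ) = 1 then 1 else 0)
      - (if (i : ℕ) = N - 1 then 1 else 0) * (if (j : ℕ) = 1 then 1 else 0)
        * (if (k : ℕ) = 0 then 1 else 0) := by
  let e : Fin N → ℕ → ℝ := fun i s => if (i : ℕ) = s then 1 else 0
  change Matrix.det (Matrix.of fun r s : Fin 3 => e (![i, j, k] r) (![0, 1, N - 1] s)) =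
    e i 0 * e j 1 * e k (N - 1) - e i 0 * e j (N - 1) * e k 1 - e i 1 * e j 0 * e k (N - 1)
      + e i 1 * e j (N - 1) * e k 0 + e i (N - 1) * e j 0 * e k 1 - e i (N - 1) * e j 1 * e k 0
  rw [Matrix.det_fin_three]
  simp only [Matrix.of_apply, Matrix.cons_val_zero, Matrix.cons_val_one, Matrix.cons_val]

theorem leviCivitaTensor_swap_left {N : ℕ} (i j k : Fin N) :
    leviCivitaTensor N i j k = -leviCivitaTensor N j i k := by
  rw [leviCivitaTensor_apply, leviCivitaTensor_apply]
  ring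

theorem leviCivitaTensor_swap_right {N : ℕ} (i j k : Fin N) :
    leviCivitaTensor N i j k = -leviCivitaTensor N i k j := by
  rw [leviCivitaTensor_apply, leviCivitaTensor_apply]
  ring

theorem sum_indicator_mul {N : ℕ} {p q r : ℕ} (hp : p < N) (hq : q < N) (hr : r < N)
    (a b c : Fin N → ℝ) :
    ∑ i : Fin N, ∑ j : Fin N, ∑ k : Fin N, (if (i : ℕ) = p then (1 : ℝ) else 0) *
      (if (j : ℕ) = q then 1 else 0) * (if (k : ℕ) = r then 1 else 0) * a i * b j * c k =
      a ⟨p, hp⟩ * b ⟨q, hq⟩ * c ⟨r, hr⟩ := by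
  rw [Finset.sum_eq_single ⟨p, hp⟩, Finset.sum_eq_single ⟨q, hq⟩, Finset.sum_eq_single ⟨r, hr⟩]
  · simp
  all_goals simp +contextual [Fin.ext_iff]

/-- The bracket of the Levi-Civita tensor is a `3 × 3` Jacobian determinant. -/
theorem nambuBracket_leviCivitaTensor {N : ℕ} (hN : 3 ≤ N) (A B C : Phase N → ℝ) (x : Phase N) :
    nambuBracket (fun _ => leviCivitaTensor N) A B C x =
      pderiv ⟨0, by omega⟩ A x * pderiv ⟨1, by omega⟩ B x * pderiv ⟨N - 1, by omega⟩ C x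
      - pderiv ⟨0, by omega⟩ A x * pderiv ⟨N - 1, by omega⟩ B x * pderiv ⟨1, by omega⟩ C x
      - pderiv ⟨1, by omega⟩ A x * pderiv ⟨0, by omega⟩ B x * pderiv ⟨N - 1, by omega⟩ C x
      + pderiv ⟨1, by omega⟩ A x * pderiv ⟨N - 1, by omega⟩ B x * pderiv ⟨0, by omega⟩ C x
      + pderiv ⟨N - 1, by omega⟩ A x * pderiv ⟨0, by omega⟩ B x * pderiv ⟨1, by omega⟩ C x
      - pderiv ⟨N - 1, by omega⟩ A x * pderiv ⟨1, by omega⟩ B x * pderiv ⟨0, by omega⟩ C x := by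
  have h0 : 0 < N := by omega
  have h1 : 1 < N := by omega
  have h2 : N - 1 < N := by omega
  have s := fun {p q r : ℕ} (hp : p < N) (hq : q < N) (hr : r < N) =>
    sum_indicator_mul hp hq hr (fun i => pderiv i A x) (fun i => pderiv i B x)
      (fun i => pderiv i C x)
  rw [← s h0 h1 h2, ← s h0 h2 h1, ← s h1 h0 h2, ← s h1 h2 h0, ← s h2 h0 h1, ← s h2 h1 h0]
  simp only [← Finset.sum_add_distrib, ← Finset.sum_sub_distrib]
  refine Finset.sum_congr rfl fun i _ => Finset.sum_congr rfl fun j _ =>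
    Finset.sum_congr rfl fun k _ => ?_
  simp only [leviCivitaTensor_apply]
  ring

theorem pderiv_comm {N : ℕ} {V : Set (Phase N)} (hV : IsOpen V) {A : Phase N → ℝ}
    (hA : IsObservable V A) {x : Phase N} (hx : x ∈ V) (i j : Fin N) :
    pderiv i (pderiv j A) x = pderiv j (pderiv i A) x := by
  have hAx : ContDiffAt ℝ ∞ A x := hA.contDiffAt (hV.mem_nhds hx)
  have hd : DifferentiableAt ℝ (fderiv ℝ A) x :=
    (hAx.fderiv_right (m := ∞) le_rfl).differentiableAt (by simp)
  have h : ∀ i j : Fin N, pderiv i (pderiv j A) x =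
      fderiv ℝ (fderiv ℝ A) x (Pi.single i 1) (Pi.single j 1) := by
    intro i j
    have h1 : HasFDerivAt (pderiv j A) _ x :=
      hd.hasFDerivAt.clm_apply (hasFDerivAt_const (Pi.single j (1 : ℝ) : Phase N) x)
    rw [pderiv, h1.fderiv]
    simp
  rw [h, h]
  exact hAx.isSymmSndFDerivAt
    (by simpa using WithTop.coe_le_coe.2 (le_top (a := (2 : ℕ∞)))) _ _

/-- As the tensor is constant, only the three first derivatives are differentiated, and symmetry of
second derivatives turns each result into a bracket. -/
theorem pderiv_nambuBracket_leviCivitaTensor {N : ℕ} {V : Set (Phase N)}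
    (hV : IsOpen V) {A B C : Phase N → ℝ} (hA : IsObservable V A) (hB : IsObservable V B)
    (hC : IsObservable V C) {x : Phase N} (hx : x ∈ V) (l : Fin N) :
    pderiv l (nambuBracket (fun _ => leviCivitaTensor N) A B C) x =
      nambuBracket (fun _ => leviCivitaTensor N) (pderiv l A) B C x
      + nambuBracket (fun _ => leviCivitaTensor N) A (pderiv l B) C x
      + nambuBracket (fun _ => leviCivitaTensor N) A B (pderiv l C) x := by
  have hd : ∀ {F : Phase N → ℝ}, IsObservable V F → ∀ i,
      HasFDerivAt (pderiv i F) (fderiv ℝ (pderiv i F) x) x := fun hF i =>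
    ((contDiffOn_pderiv hV hF i).differentiableAt hV hx).hasFDerivAt
  have ht : ∀ (c : ℝ) (i j k : Fin N), HasFDerivAt
      (fun y => c * pderiv i A y * pderiv j B y * pderiv k C y) _ x := fun c i j k =>
    (((hd hA i).const_mul c).mul (hd hB j)).mul (hd hC k)
  have hs := HasFDerivAt.fun_sum fun i (_ : i ∈ Finset.univ) =>
    HasFDerivAt.fun_sum fun j (_ : j ∈ Finset.univ) =>
      HasFDerivAt.fun_sum fun k (_ : k ∈ Finset.univ) => ht (leviCivitaTensor N i j k) i j k
  have h1 : pderiv l (nambuBracket (fun _ => leviCivitaTensor N) A B C) x = _ :=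
    congrArg (fun T : Phase N →L[ℝ] ℝ => T (Pi.single l 1)) hs.fderiv
  rw [h1]
  simp only [nambuBracket, ← Finset.sum_add_distrib, FunLike.coe_sum, Finset.sum_apply]
  refine Finset.sum_congr rfl fun i _ => Finset.sum_congr rfl fun j _ =>
    Finset.sum_congr rfl fun k _ => ?_
  rw [pderiv_comm hV hA hx i l, pderiv_comm hV hB hx j l, pderiv_comm hV hC hx k l]
  simp only [add_apply, smul_apply, smul_eq_mul, Pi.mul_apply, pderiv]
  ring

end LeviCivita

/-- Nambu's fundamental identity for the Jacobian determinant in three of the variables. -/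
theorem nambuBracket_leviCivitaTensor_fundamental {N : ℕ} (hN : 3 ≤ N) {V : Set (Phase N)}
    (hV : IsOpen V) {A B C D E : Phase N → ℝ} (hA : IsObservable V A) (hB : IsObservable V B)
    (hC : IsObservable V C) (hD : IsObservable V D) (hE : IsObservable V E) {x : Phase N}
    (hx : x ∈ V) :
    nambuBracket (fun _ => leviCivitaTensor N)
        (nambuBracket (fun _ => leviCivitaTensor N) A B C) D E x
      = nambuBracket (fun _ => leviCivitaTensor N)
          (nambuBracket (fun _ => leviCivitaTensor N) A D E) B C x
        + nambuBracket (fun _ => leviCivitaTensor N)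
          A (nambuBracket (fun _ => leviCivitaTensor N) B D E) C x
        + nambuBracket (fun _ => leviCivitaTensor N)
          A B (nambuBracket (fun _ => leviCivitaTensor N) C D E) x := by
  have hd := fun {A B C : Phase N → ℝ} (hA : IsObservable V A) (hB : IsObservable V B)
    (hC : IsObservable V C) (l : Fin N) => pderiv_nambuBracket_leviCivitaTensor hV hA hB hC hx l
  simp only [nambuBracket_leviCivitaTensor hN _ D E, nambuBracket_leviCivitaTensor hN _ B C,
    nambuBracket_leviCivitaTensor hN A _ C, nambuBracket_leviCivitaTensor hN A B _,
    hd hA hB hC, hd hA hD hE, hd hB hD hE, hd hC hD hE]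
  simp only [nambuBracket_leviCivitaTensor hN]
  -- The actual indices no longer matter: once mixed derivatives are put in one order, the claim is
  -- a polynomial identity in first and second derivatives.
  generalize (⟨0, _⟩ : Fin N) = p
  generalize (⟨1, _⟩ : Fin N) = q
  generalize (⟨N - 1, _⟩ : Fin N) = r
  rw [pderiv_comm hV hA hx q p, pderiv_comm hV hA hx r p, pderiv_comm hV hA hx r q,
    pderiv_comm hV hB hx q p, pderiv_comm hV hB hx r p, pderiv_comm hV hB hx r q,
    pderiv_comm hV hC hx q p, pderiv_comm hV hC hx r p, pderiv_comm hV hC hx r q,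
    pderiv_comm hV hD hx q p, pderiv_comm hV hD hx r p, pderiv_comm hV hD hx r q,
    pderiv_comm hV hE hx q p, pderiv_comm hV hE hx r p, pderiv_comm hV hE hx r q]
  ring

theorem poissonBracket_congr {N : ℕ} {J : Phase N → Matrix (Fin N) (Fin N) ℝ}
    {A A' B B' : Phase N → ℝ} {z : Phase N} (hA : A =ᶠ[𝓝 z] A') (hB : B =ᶠ[𝓝 z] B') :
    poissonBracket J A B z = poissonBracket J A' B' z := by
  simp only [poissonBracket, (hA.pderiv _).eq_of_nhds, (hB.pderiv _).eq_of_nhds]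

/-! ### Invariance of brackets under changes of variables -/

section ChangeOfVariables

variable {N : ℕ}

/-- The chain rule in coordinates. -/
theorem pderiv_comp {A : Phase N → ℝ} {g : Phase N → Phase N} {x : Phase N}
    (hA : DifferentiableAt ℝ A (g x)) (hg : DifferentiableAt ℝ g x) (m : Fin N) :
    pderiv m (A ∘ g) x = ∑ i, pderiv i A (g x) * pderiv m (fun y => g y i) x := by
  rw [pderiv, fderiv_comp x hA hg, ContinuousLinearMap.comp_apply, fderiv_eq_sum_pderiv]
  refine Finset.sum_congr rfl fun i _ => ?_
  rw [mul_comm, pderiv, pderiv, fderiv_apply hg i]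
  rfl

/-- Summing over pairs as a single index lets one exchange of sums move all old indices past all new
ones. -/
theorem sum_pushforward_two {ι : Type*} [Fintype ι] (T : ι → ι → ℝ) (D : ι → ι → ℝ)
    (a b : ι → ℝ) :
    ∑ m, ∑ n, T m n * (∑ i, a i * D m i) * (∑ j, b j * D n j) =
      ∑ i, ∑ j, (∑ m, ∑ n, T m n * D m i * D n j) * a i * b j := by
  have h : ∀ F : ι × ι → ι × ι → ℝ, ∑ x, ∑ y, F x y = ∑ y, ∑ x, F x y := fun F =>
    Finset.sum_comm
  have h1 := h fun x y => T x.1 x.2 * (a y.1 * D x.1 y.1) * (b y.2 * D x.2 y.2)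
  simp only [Fintype.sum_prod_type] at h1
  convert h1 using 1
  · refine Finset.sum_congr rfl fun m _ => Finset.sum_congr rfl fun n _ => ?_
    simp only [← Finset.mul_sum, ← Finset.sum_mul]
  · refine Finset.sum_congr rfl fun i _ => Finset.sum_congr rfl fun j _ => ?_
    simp only [Finset.sum_mul]
    refine Finset.sum_congr rfl fun m _ => Finset.sum_congr rfl fun n _ => ?_
    ring

theorem sum_pushforward_three {ι : Type*} [Fintype ι] (T : ι → ι → ι → ℝ) (D : ι → ι → ℝ)
    (a b c : ι → ℝ) :
    ∑ m, ∑ n, ∑ p, T m n p * (∑ i, a i * D m i) * (∑ j, b j * D n j) * (∑ k, c k * D p k) =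
      ∑ i, ∑ j, ∑ k, (∑ m, ∑ n, ∑ p, T m n p * D m i * D n j * D p k) * a i * b j * c k := by
  have h : ∀ F : ι × ι × ι → ι × ι × ι → ℝ, ∑ x, ∑ y, F x y = ∑ y, ∑ x, F x y := fun F =>
    Finset.sum_comm
  have h1 := h fun x y => T x.1 x.2.1 x.2.2 * (a y.1 * D x.1 y.1) * (b y.2.1 * D x.2.1 y.2.1) *
    (c y.2.2 * D x.2.2 y.2.2)
  simp only [Fintype.sum_prod_type] at h1
  convert h1 using 1
  · refine Finset.sum_congr rfl fun m _ => Finset.sum_congr rfl fun n _ =>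
      Finset.sum_congr rfl fun p _ => ?_
    simp only [← Finset.mul_sum, ← Finset.sum_mul]
  · refine Finset.sum_congr rfl fun i _ => Finset.sum_congr rfl fun j _ =>
      Finset.sum_congr rfl fun k _ => ?_
    simp only [Finset.sum_mul]
    refine Finset.sum_congr rfl fun m _ => Finset.sum_congr rfl fun n _ =>
      Finset.sum_congr rfl fun p _ => ?_
    ring

/-- Tensors transform so that the trilinear bracket is invariant. -/
theorem nambuBracket_changeTensor (h g : Phase N → Phase N)
    (L : Phase N → Fin N → Fin N → Fin N → ℝ) {A B C : Phase N → ℝ} {x : Phase N}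
    (hh : DifferentiableAt ℝ h (g x)) (hA : DifferentiableAt ℝ A (h (g x)))
    (hB : DifferentiableAt ℝ B (h (g x))) (hC : DifferentiableAt ℝ C (h (g x)))
    (hx : h (g x) = x) :
    nambuBracket (changeTensor h g L) A B C x =
      nambuBracket L (A ∘ h) (B ∘ h) (C ∘ h) (g x) := by
  simp only [nambuBracket, changeTensor, pderiv_comp hA hh, pderiv_comp hB hh, pderiv_comp hC hh]
  rw [hx]
  exact (sum_pushforward_three (fun m n p => L (g x) m n p)
    (fun m i => pderiv m (fun z => h z i) (g x)) _ _ _).symm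

/-- Matrix fields transform so that the bilinear bracket is invariant. -/
theorem poissonBracket_changeMatrix (h g : Phase N → Phase N)
    (J : Phase N → Matrix (Fin N) (Fin N) ℝ) {A B : Phase N → ℝ} {x : Phase N}
    (hh : DifferentiableAt ℝ h (g x)) (hA : DifferentiableAt ℝ A (h (g x)))
    (hB : DifferentiableAt ℝ B (h (g x))) (hx : h (g x) = x) :
    poissonBracket (changeMatrix h g J) A B x = poissonBracket J (A ∘ h) (B ∘ h) (g x) := by
  simp only [poissonBracket, changeMatrix, pderiv_comp hA hh, pderiv_comp hB hh]
  rw [hx]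
  exact (sum_pushforward_two (fun m n => J (g x) m n)
    (fun m i => pderiv m (fun z => h z i) (g x)) _ _).symm

end ChangeOfVariables

/-! ### The Levi-Civita bracket in Darboux coordinates -/

section Charts

variable {N : ℕ} {h : OpenPartialHomeomorph (Phase N) (Phase N)}

theorem contDiffOn_changeTensor_symm (hs : ContDiffOn ℝ ∞ h h.source)
    (hs' : ContDiffOn ℝ ∞ h.symm h.target) (ε : Fin N → Fin N → Fin N → ℝ) (i j k : Fin N) :
    ContDiffOn ℝ ∞ (fun z => changeTensor h.symm h (fun _ => ε) z i j k) h.source := by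
  have hd : ∀ m i, ContDiffOn ℝ ∞ (fun z => pderiv m (fun x => h.symm x i) (h z)) h.source :=
    fun m i => (contDiffOn_pderiv h.open_target (contDiffOn_pi.1 hs' i) m).comp hs
      fun z hz => h.map_source hz
  exact ContDiffOn.sum fun m _ => ContDiffOn.sum fun n _ => ContDiffOn.sum fun p _ =>
    ((contDiffOn_const.mul (hd m i)).mul (hd n j)).mul (hd p k)

theorem nambuBracket_changeTensor_symm (hs' : ContDiffOn ℝ ∞ h.symm h.target)
    (ε : Fin N → Fin N → Fin N → ℝ) {A B C : Phase N → ℝ} {z : Phase N} (hz : z ∈ h.source)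
    (hA : DifferentiableAt ℝ A z) (hB : DifferentiableAt ℝ B z) (hC : DifferentiableAt ℝ C z) :
    nambuBracket (changeTensor h.symm h (fun _ => ε)) A B C z =
      nambuBracket (fun _ => ε) (A ∘ h.symm) (B ∘ h.symm) (C ∘ h.symm) (h z) := by
  have hz' := h.left_inv hz
  refine nambuBracket_changeTensor h.symm h (fun _ => ε) ?_ ?_ ?_ ?_ hz'
  · exact (hs'.contDiffAt (h.open_target.mem_nhds (h.map_source hz))).differentiableAt (by simp)
  all_goals rwa [hz']

/-- The fundamental identity is transported: each bracket, inner ones included, equals the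
constant-coefficient bracket of the observables composed with `h.symm`. Inner brackets must agree
near the point, because they are differentiated again. Any smooth chart will do. -/
theorem isNambuOn_leviCivitaTensor (hN : 3 ≤ N) (hs : ContDiffOn ℝ ∞ h h.source)
    (hs' : ContDiffOn ℝ ∞ h.symm h.target) :
    IsNambuOn h.source (changeTensor h.symm h (fun _ => leviCivitaTensor N)) where
  smooth := contDiffOn_changeTensor_symm hs hs' _
  skew_left := fun z _ i j k => by
    simp only [changeTensor]
    rw [Finset.sum_comm]
    simp only [← Finset.sum_neg_distrib]
    refine Finset.sum_congr rfl fun m _ => Finset.sum_congr rfl fun n _ =>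
      Finset.sum_congr rfl fun p _ => ?_
    rw [leviCivitaTensor_swap_left]
    ring
  skew_right := fun z _ i j k => by
    simp only [changeTensor, ← Finset.sum_neg_distrib]
    refine Finset.sum_congr rfl fun m _ => ?_
    rw [Finset.sum_comm]
    refine Finset.sum_congr rfl fun n _ => Finset.sum_congr rfl fun p _ => ?_
    rw [leviCivitaTensor_swap_right]
    ring
  fundamental := fun A B C D E hA hB hC hD hE z hz => by
    set L := changeTensor h.symm h (fun _ => leviCivitaTensor N) with hL
    have hsm : ∀ i j k, ContDiffOn ℝ ∞ (fun z => L z i j k) h.source :=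
      contDiffOn_changeTensor_symm hs hs' _
    have ho := h.open_source
    have hd : ∀ {F : Phase N → ℝ}, IsObservable h.source F → DifferentiableAt ℝ F z :=
      fun hF => hF.differentiableAt ho hz
    have hb : ∀ {F G H : Phase N → ℝ}, IsObservable h.source F → IsObservable h.source G →
        IsObservable h.source H → DifferentiableAt ℝ (nambuBracket L F G H) z :=
      fun hF hG hH => hd (isObservable_nambuBracket ho hsm hF hG hH)
    have hp : ∀ {F : Phase N → ℝ}, IsObservable h.source F →
        IsObservable h.target (F ∘ h.symm) := fun hF => hF.comp hs' fun x hx => h.map_target hx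
    have he : ∀ {F G H : Phase N → ℝ}, IsObservable h.source F → IsObservable h.source G →
        IsObservable h.source H → nambuBracket L F G H ∘ h.symm =ᶠ[𝓝 (h z)]
          nambuBracket (fun _ => leviCivitaTensor N) (F ∘ h.symm) (G ∘ h.symm) (H ∘ h.symm) := by
      intro F G H hF hG hH
      filter_upwards [h.open_target.mem_nhds (h.map_source hz)] with x hx
      have hx' := h.map_target hx
      rw [Function.comp_apply, hL, nambuBracket_changeTensor_symm hs' _ hx'
        (hF.differentiableAt ho hx') (hG.differentiableAt ho hx') (hH.differentiableAt ho hx'),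
        h.right_inv hx]
    have hr : ∀ X : Phase N → ℝ, X =ᶠ[𝓝 (h z)] X := fun _ => EventuallyEq.rfl
    have hc : ∀ {F G H : Phase N → ℝ}, DifferentiableAt ℝ F z → DifferentiableAt ℝ G z →
        DifferentiableAt ℝ H z → nambuBracket L F G H z =
          nambuBracket (fun _ => leviCivitaTensor N) (F ∘ h.symm) (G ∘ h.symm) (H ∘ h.symm) (h z) :=
      fun hF hG hH => nambuBracket_changeTensor_symm hs' _ hz hF hG hH
    rw [hc (hb hA hB hC) (hd hD) (hd hE), hc (hb hA hD hE) (hd hB) (hd hC),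
      hc (hd hA) (hb hB hD hE) (hd hC), hc (hd hA) (hd hB) (hb hC hD hE),
      nambuBracket_congr (he hA hB hC) (hr _) (hr _), nambuBracket_congr (he hA hD hE) (hr _) (hr _),
      nambuBracket_congr (hr _) (he hB hD hE) (hr _), nambuBracket_congr (hr _) (hr _) (he hC hD hE)]
    exact nambuBracket_leviCivitaTensor_fundamental hN h.open_target (hp hA) (hp hB) (hp hC)
      (hp hD) (hp hE) (h.map_source hz)

theorem poissonBracket_darbouxMatrix (hN : 3 ≤ N) (A B : Phase N → ℝ) (x : Phase N) :
    poissonBracket (fun _ => darbouxMatrix N 1) A B x =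
      pderiv ⟨0, by omega⟩ A x * pderiv ⟨1, by omega⟩ B x
        - pderiv ⟨1, by omega⟩ A x * pderiv ⟨0, by omega⟩ B x := by
  have h1 : ∀ i j : Fin N, darbouxMatrix N 1 i j =
      (if i = ⟨0, by omega⟩ then 1 else 0) * (if j = ⟨1, by omega⟩ then 1 else 0)
        - (if i = ⟨1, by omega⟩ then 1 else 0) * (if j = ⟨0, by omega⟩ then 1 else 0) := by
    intro i j
    rw [darbouxMatrix_one_apply]
    simp only [Fin.ext_iff]
    split_ifs <;> first | omega | norm_num
  simp only [poissonBracket, h1, sub_mul, Finset.sum_sub_distrib, ite_mul, one_mul, zero_mul,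
    Finset.sum_ite_irrel, Finset.sum_const_zero, Finset.sum_ite_eq', Finset.mem_univ, if_true]

/-- In the new variables the last slot holds x_N, whose only nonzero derivative is along the last
index. The determinant reduces to its 2 × 2 minor in the first two variables, which is the canonical
bracket. -/
theorem IsDarbouxChart.generates (hN : 3 ≤ N) {J : Phase N → Matrix (Fin N) (Fin N) ℝ}
    (hJ : IsDarbouxChart 1 h J) :
    Generates h.source (changeTensor h.symm h (fun _ => leviCivitaTensor N))
      (fun z => h z ⟨N - 1, by omega⟩) J := by
  have hC : IsObservable h.source fun z => h z ⟨N - 1, by omega⟩ := contDiffOn_pi.1 hJ.smooth _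
  refine ⟨hC, fun A B hA hB z hz => ?_⟩
  have ho := h.open_source
  have hx := h.map_source hz
  have hA' : IsObservable h.target (A ∘ h.symm) :=
    hA.comp hJ.smooth_symm fun x hx => h.map_target hx
  have hB' : IsObservable h.target (B ∘ h.symm) :=
    hB.comp hJ.smooth_symm fun x hx => h.map_target hx
  have hback : ∀ F : Phase N → ℝ, F =ᶠ[𝓝 z] (F ∘ h.symm) ∘ h := fun F => by
    filter_upwards [h.open_source.mem_nhds hz] with y hy
    simp [h.left_inv hy]
  have hz' := h.left_inv hz
  have h1 := poissonBracket_changeMatrix h h.symm J (A := A ∘ h.symm) (B := B ∘ h.symm) (x := h z)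
    (by
      rw [hz']
      exact (hJ.smooth.contDiffAt (ho.mem_nhds hz)).differentiableAt (by simp))
    (by
      rw [hz']
      exact hA'.differentiableAt h.open_target hx)
    (by
      rw [hz']
      exact hB'.differentiableAt h.open_target hx) (by rw [hz'])
  have h2 : poissonBracket (changeMatrix h h.symm J) (A ∘ h.symm) (B ∘ h.symm) (h z) =
      poissonBracket (fun _ => darbouxMatrix N 1) (A ∘ h.symm) (B ∘ h.symm) (h z) := by
    simp only [poissonBracket, hJ.normal_form _ hx]
  have h3 : (fun z => h z ⟨N - 1, by omega⟩) ∘ h.symm =ᶠ[𝓝 (h z)]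
      fun y : Phase N => y ⟨N - 1, by omega⟩ := by
    filter_upwards [h.open_target.mem_nhds hx] with y hy
    simp [h.right_inv hy]
  rw [poissonBracket_congr (hback A) (hback B)]
  rw [hz'] at h1
  rw [← h1, h2, nambuBracket_changeTensor_symm hJ.smooth_symm _ hz (hA.differentiableAt ho hz)
    (hB.differentiableAt ho hz) (hC.differentiableAt ho hz),
    nambuBracket_congr EventuallyEq.rfl EventuallyEq.rfl h3, nambuBracket_leviCivitaTensor hN,
    poissonBracket_darbouxMatrix hN]
  -- Here `3 ≤ N` is essential: the last index must differ from the first two for the other four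
  -- terms to vanish.
  have e0 : N - 1 ≠ 0 := by omega
  have e1 : N - 1 ≠ 1 := by omega
  simp only [pderiv_coordinate, Fin.mk.injEq, e0, e1, if_true, if_false]
  ring

end Charts

end Nambu

/-! ### The main theorem -/

theorem mainTheorem1 (N K M : ℕ) (hN : 3 ≤ N) (hM : 1 ≤ M) (hNKM : N = K + 2 * M)
    (Ω : Set (Nambu.Phase N)) (hΩ : IsOpen Ω)
    (J : Nambu.Phase N → Matrix (Fin N) (Fin N) ℝ)
    (hJ : Nambu.IsPoissonOn Ω J) (hrank : ∀ z ∈ Ω, (J z).rank = 2 * M) :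
    -- necessary and sufficient condition, near every point
    (∀ z ∈ Ω, (∃ V : Set (Nambu.Phase N),
        IsOpen V ∧ z ∈ V ∧ V ⊆ Ω ∧ Nambu.HasNambuBracketOn V J) ↔ N = K + 2) ∧
    -- necessity: a Nambu bracket imposes the quadratic relations on `J`, which force `N = K + 2`
    (∀ V : Set (Nambu.Phase N), IsOpen V → V ⊆ Ω →
        Nambu.HasNambuBracketOn V J → ∀ z ∈ V, Nambu.QuadraticRelations (J z)) ∧
    (∀ z ∈ Ω, Nambu.QuadraticRelations (J z) → N = K + 2) ∧
    -- sufficiency: Darboux variables exist near every point, and in all such variables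
    -- the Levi-Civita tensor and the last variable generate the Poisson bracket
    (N = K + 2 →
      (∀ z ∈ Ω, ∃ h : OpenPartialHomeomorph (Nambu.Phase N) (Nambu.Phase N),
        z ∈ h.source ∧ h.source ⊆ Ω ∧ Nambu.IsDarbouxChart 1 h J) ∧
      (∀ h : OpenPartialHomeomorph (Nambu.Phase N) (Nambu.Phase N),
        h.source ⊆ Ω → Nambu.IsDarbouxChart 1 h J →
          Nambu.IsNambuOn h.source
            (Nambu.changeTensor h.symm h (fun _ => Nambu.leviCivitaTensor N)) ∧
          Nambu.Generates h.source
            (Nambu.changeTensor h.symm h (fun _ => Nambu.leviCivitaTensor N))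
            (fun z => h z ⟨N - 1, by omega⟩) J)) := by
  have hquad : ∀ V : Set (Nambu.Phase N), IsOpen V → V ⊆ Ω →
      Nambu.HasNambuBracketOn V J → ∀ z ∈ V, Nambu.QuadraticRelations (J z) :=
    fun V hV hVΩ h z hz => h.quadraticRelations hV (fun y hy => hJ.skew y (hVΩ hy)) hz
  have hdim : ∀ z ∈ Ω, Nambu.QuadraticRelations (J z) → N = K + 2 := by
    intro z hz h
    have h1 := h.rank_le_two (hJ.skew z hz)
    rw [hrank z hz] at h1
    omega
  have hdarboux : N = K + 2 →
      ∀ z ∈ Ω, ∃ h : OpenPartialHomeomorph (Nambu.Phase N) (Nambu.Phase N),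
        z ∈ h.source ∧ h.source ⊆ Ω ∧ Nambu.IsDarbouxChart 1 h J := by
    intro hK z hz
    obtain rfl : M = 1 := by omega
    subst hK
    exact Nambu.exists_darbouxChart hΩ hJ hrank hz
  refine ⟨fun z hz => ⟨?_, fun hK => ?_⟩, hquad, hdim, fun hK => ⟨hdarboux hK, fun h _ hh =>
    ⟨Nambu.isNambuOn_leviCivitaTensor hN hh.smooth hh.smooth_symm, hh.generates hN⟩⟩⟩
  · rintro ⟨V, hV, hzV, hVΩ, h⟩
    exact hdim z hz (hquad V hV hVΩ h z hzV)
  · obtain ⟨h, hzh, hhΩ, hh⟩ := hdarboux hK z hz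
    exact ⟨h.source, h.open_source, hzh, hhΩ, _, _,
      Nambu.isNambuOn_leviCivitaTensor hN hh.smooth hh.smooth_symm, hh.generates hN⟩
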